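/- Let $n\ge 2$, $b_n=\frac{n(n-1)}2$, $c_n=n-1$. Let $K=\mathrm{U}(n)\subset G=\mathrm{GL}_n(\mathbb C)$, let $\mathrm{GU}(n)=\{g\in G : g\,\bar g^{\,t}\text{ is a scalar matrix}\}$, let $\mathfrak g=\mathfrak{gl}_n(\mathbb C)\oplus\mathfrak{gl}_n(\mathbb C)$ be the complexified Lie algebra of the real Lie group $G$ (via $X\mapsto (X,\bar X)$), and let $\tilde{\mathfrak k}\subset\mathfrak g$ be the complexified Lie algebra of $\mathrm{GU}(n)$; $K$ acts on $\mathfrak g/\tilde{\mathfrak k}$ by the adjoint action, and $K^3=K\times K\times K$ acts on $(\mathfrak g/\tilde{\mathfrak k})^3$ factor by factor. For a dominant weight $\lambda\in\mathbb Z^n$ let $E_\lambda$ denote the irreducible continuous finite-dimensional complex representation of $K$ of highest weight $\lambda$, and put $$\tau_n=E_{(n-1,\,n-3,\,\dots,\,3-n,\,1-n)},\qquad \sigma_n=E_{(n-1,-1,\dots,-1)}\ \text{ or }\ \sigma_n=E_{(1,\dots,1,1-n)}.$$ Let $\tau_n\boxtimes\tau_n\boxtimes\sigma_n$ be the outer tensor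 product (a representation of $K^3$), whose restriction to the diagonal $K\subset K^3$ is $\tau_n\otimes\tau_n\otimes\sigma_n$. Let $$\eta_n\in \mathrm{Hom}_{K^3}\bigl(\wedge^{2b_n+c_n}((\mathfrak g/\tilde{\mathfrak k})^3),\ \tau_n\boxtimes\tau_n\boxtimes\sigma_n\bigr)$$ be any nonzero element, and let $\iota_n:\wedge^{2b_n+c_n}(\mathfrak g/\tilde{\mathfrak k})\to\wedge^{2b_n+c_n}((\mathfrak g/\tilde{\mathfrak k})^3)$ be the map induced by the diagonal embedding $\mathfrak g/\tilde{\mathfrak k}\to(\mathfrak g/\tilde{\mathfrak k})^3$. Then the composition $\eta_n\circ\iota_n$ is nonzero, and its image is equal to the space of invariants $(\tau_n\otimes\tau_n\otimes\sigma_n)^K$, which is one-dimensional. -/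

import Mathlib

open scoped TensorProduct Matrix

noncomputable section

namespace RankinSelberg

/-- `𝔤 = 𝔤𝔩ₙ(ℂ) ⊕ 𝔤𝔩ₙ(ℂ)`, the complexification of the real Lie algebra `𝔤₀ = 𝔤𝔩ₙ(ℂ)` of
`G = GLₙ(ℂ)`, the inclusion of `𝔤₀` being `complexify`. -/
abbrev LieG (n : ℕ) : Type := Matrix (Fin n) (Fin n) ℂ × Matrix (Fin n) (Fin n) ℂ

/-- The compact group `K = U(n)`. -/
abbrev K (n : ℕ) : Type := Matrix.unitaryGroup (Fin n) ℂ

/-- The differential `X ↦ (X, X̄)` of the complexification map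
`GLₙ(ℂ) → GLₙ(ℂ) × GLₙ(ℂ)`, `g ↦ (g, ḡ)`. -/
def complexify (n : ℕ) (X : Matrix (Fin n) (Fin n) ℂ) : LieG n := (X, X.map star)

/-- The real Lie algebra of `GU(n) = {g ∈ GLₙ(ℂ) | g ḡᵗ is a scalar matrix}`:
all `X` for which `X + X̄ᵗ` is a scalar matrix. -/
def lieGU (n : ℕ) : Set (Matrix (Fin n) (Fin n) ℂ) :=
  {X | ∃ c : ℂ, X + Xᴴ = c • (1 : Matrix (Fin n) (Fin n) ℂ)}

/-- `𝔨̃ ⊆ 𝔤`, the complexified Lie algebra of `GU(n)`. -/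
def kTilde (n : ℕ) : Submodule ℂ (LieG n) :=
  Submodule.span ℂ (complexify n '' lieGU n)

/-- The adjoint action of `K` on `𝔤`; an element `k` acts through `(k, k̄)`,
that is by `(A, B) ↦ (k A k⁻¹, k̄ B k̄⁻¹)`. -/
def adG (n : ℕ) : Representation ℂ (K n) (LieG n) where
  toFun k :=
    { toFun := fun X =>
        (k.1 * X.1 * k.1ᴴ, k.1.map star * X.2 * (k.1.map star)ᴴ)
      map_add' := fun X Y => by simp [mul_add, add_mul]
      map_smul' := fun c X => by simp }
  map_one' := by
    ext1 <;> ext1 <;> simp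
  map_mul' k l := by
    have h : (k.1 * l.1).map star = k.1.map star * l.1.map star := by
      ext i j; simp [Matrix.mul_apply]
    refine LinearMap.ext fun X => ?_
    refine Prod.ext ?_ ?_
    · simp [Matrix.conjTranspose_mul, Matrix.mul_assoc]
    · change (k.1 * l.1).map star * X.2 * ((k.1 * l.1).map star)ᴴ = _
      rw [h]
      simp [Matrix.conjTranspose_mul, Matrix.mul_assoc]

theorem kTilde_le_comap (n : ℕ) (k : K n) : kTilde n ≤ (kTilde n).comap (adG n k) := by
  refine Submodule.span_le.2 ?_
  rintro _ ⟨X, ⟨c, hc⟩, rfl⟩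
  refine Submodule.subset_span ⟨k.1 * X * k.1ᴴ, ⟨c, ?_⟩, ?_⟩
  · have hk : k.1 * k.1ᴴ = 1 := Matrix.mem_unitaryGroup_iff.1 k.2
    calc k.1 * X * k.1ᴴ + (k.1 * X * k.1ᴴ)ᴴ = k.1 * (X + Xᴴ) * k.1ᴴ := by
          simp [Matrix.conjTranspose_mul, mul_add, add_mul, Matrix.mul_assoc]
      _ = c • 1 := by rw [hc]; simp [hk]
  · refine Prod.ext rfl ?_
    change (k.1 * X * k.1ᴴ).map star = k.1.map star * X.map star * (k.1.map star)ᴴ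
    ext i j
    simp [Matrix.mul_apply]

/-- `𝔤/𝔨̃`. -/
abbrev GModK (n : ℕ) : Type := LieG n ⧸ kTilde n

/-- The representation of `K` on `𝔤/𝔨̃`. -/
def adGModK (n : ℕ) : Representation ℂ (K n) (GModK n) :=
  (adG n).quotient (kTilde n) (kTilde_le_comap n)

/-- The projections of `K × K × K`. -/
def pr₁ (n : ℕ) : K n × K n × K n →* K n := MonoidHom.fst _ _
def pr₂ (n : ℕ) : K n × K n × K n →* K n := (MonoidHom.fst _ _).comp (MonoidHom.snd _ _)
def pr₃ (n : ℕ) : K n × K n × K n →* K n := (MonoidHom.snd _ _).comp (MonoidHom.snd _ _)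

/-- The representation of `K × K × K` on `(𝔤/𝔨̃)³`, each factor acting on its own summand. -/
def adGModKCube (n : ℕ) :
    Representation ℂ (K n × K n × K n) (GModK n × GModK n × GModK n) :=
  Representation.prod ((adGModK n).comp (pr₁ n))
    (Representation.prod ((adGModK n).comp (pr₂ n)) ((adGModK n).comp (pr₃ n)))

/-- The exterior power `∧ᵈ ρ` of a representation. -/
def extPower {G V : Type*} [Monoid G] [AddCommGroup V] [Module ℂ V]
    (ρ : Representation ℂ G V) (d : ℕ) : Representation ℂ G (⋀[ℂ]^d V) where
  toFun g := exteriorPower.map d (ρ g)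
  map_one' := by rw [map_one]; exact exteriorPower.map_id
  map_mul' g h := by
    rw [map_mul, Module.End.mul_eq_comp, Module.End.mul_eq_comp]
    exact exteriorPower.map_comp (ρ h) (ρ g)

/-- The outer tensor product `α ⊠ β ⊠ γ`, a representation of `K × K × K`. -/
def outerTensor {n : ℕ} {U V W : Type*} [AddCommGroup U] [Module ℂ U] [AddCommGroup V]
    [Module ℂ V] [AddCommGroup W] [Module ℂ W] (α : Representation ℂ (K n) U)
    (β : Representation ℂ (K n) V) (γ : Representation ℂ (K n) W) :
    Representation ℂ (K n × K n × K n) (U ⊗[ℂ] (V ⊗[ℂ] W)) :=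
  Representation.tprod (α.comp (pr₁ n))
    (Representation.tprod (β.comp (pr₂ n)) (γ.comp (pr₃ n)))

/-- The diagonal matrix with entries `t₁, …, tₙ` on the unit circle, as an element of `U(n)`. -/
def diagTorus {n : ℕ} (t : Fin n → Circle) : K n :=
  ⟨Matrix.diagonal fun i => (t i : ℂ), by
    rw [Matrix.mem_unitaryGroup_iff, Matrix.star_eq_conjTranspose, Matrix.diagonal_conjTranspose,
      Matrix.diagonal_mul_diagonal, ← Matrix.diagonal_one]
    congr 1
    funext i
    simp [Complex.mul_conj, Circle.normSq_coe]⟩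

/-- `μ ∈ ℤⁿ` is a weight of `ρ`: some nonzero vector is acted upon by every
`diag(t₁, …, tₙ) ∈ U(n)` as the scalar `t₁^μ₁ ⋯ tₙ^μₙ`. -/
def IsWeight {n : ℕ} {V : Type*} [AddCommGroup V] [Module ℂ V] (ρ : Representation ℂ (K n) V)
    (μ : Fin n → ℤ) : Prop :=
  ∃ v : V, v ≠ 0 ∧ ∀ t : Fin n → Circle, ρ (diagTorus t) v = (∏ i, (t i : ℂ) ^ μ i) • v

/-- The cone of sums of positive roots `ε_i - ε_j`, `i < j`. -/
def posRootCone (n : ℕ) : AddSubmonoid (Fin n → ℤ) :=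
  AddSubmonoid.closure {α | ∃ i j : Fin n, i < j ∧ α = Pi.single i 1 - Pi.single j 1}

/-- `ρ` is (a model of) the `K`-type `E_lam`: an irreducible continuous finite-dimensional
representation of `K = U(n)` of highest weight `lam`. -/
structure IsKType {n : ℕ} (lam : Fin n → ℤ) {V : Type*} [AddCommGroup V] [Module ℂ V]
    (ρ : Representation ℂ (K n) V) : Prop where
  finiteDimensional : FiniteDimensional ℂ V
  continuous : ∀ (φ : Module.Dual ℂ V) (v : V), Continuous fun k : K n => φ (ρ k v)
  irreducible : ρ.IsIrreducible
  isWeight : IsWeight ρ lam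
  highest : ∀ μ : Fin n → ℤ, IsWeight ρ μ → lam - μ ∈ posRootCone n

/-- The weight `(n-1, n-3, …, 3-n, 1-n)`. -/
def tauWeight (n : ℕ) : Fin n → ℤ := fun i => (n : ℤ) - 1 - 2 * (i : ℕ)

/-- The weight `(n-1, -1, …, -1)`. -/
def sigmaWeight (n : ℕ) : Fin n → ℤ := fun i => if (i : ℕ) = 0 then (n : ℤ) - 1 else -1

/-- The weight `(1, …, 1, 1-n)`. -/
def sigmaWeight' (n : ℕ) : Fin n → ℤ := fun i => if (i : ℕ) = n - 1 then 1 - (n : ℤ) else 1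

/-- `b_n = n(n-1)/2`. -/
def b (n : ℕ) : ℕ := n * (n - 1) / 2

/-- `c_n = n - 1`. -/
def c (n : ℕ) : ℕ := n - 1

/-- The map `ι_n : ∧^{2b_n+c_n}(𝔤/𝔨̃) → ∧^{2b_n+c_n}((𝔤/𝔨̃)³)` induced by the diagonal embedding
`𝔤/𝔨̃ → (𝔤/𝔨̃)³`. -/
def iota (n : ℕ) :
    ⋀[ℂ]^(2 * b n + c n) (GModK n) →ₗ[ℂ]
      ⋀[ℂ]^(2 * b n + c n) (GModK n × GModK n × GModK n) :=
  exteriorPower.map (2 * b n + c n)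
    (LinearMap.id.prod (LinearMap.id.prod LinearMap.id))

end RankinSelberg

end

/-! Put N = 2b_n + c_n, so that N + 1 = n². Modulo 𝔨̃ every (A, B) equals (A + Bᵀ, 0), which
identifies 𝔤/𝔨̃ with 𝔤𝔩ₙ modulo scalars, a space of dimension N. Hence ∧^N(𝔤/𝔨̃) is a top exterior
power on which K acts by the determinant of the adjoint action, namely 1, and η ∘ ι takes values in
the invariants (`comp_diagExt_mem_invariants`). It remains to show that η ∘ ι is nonzero and that
the invariants have dimension at most one.

Nonvanishing (`comp_diagExt_ne_zero`). The highest weight of τ is the sum of all positive roots;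
that of σ is the sum of the roots in the first row, or in the last column. Composing η with
functionals of highest weight on the three factors gives a nonzero alternating N-form A on 𝔤𝔩ₙ³. A
family of distinct matrix units can carry the weight of A only if it contains every root vector on
which the relevant coweight is positive (`posPairs_subset`). There are b_n + b_n + c_n = N of these,
so A sees only the projection to their span. By equivariance the diagonal may be replaced by X ↦ (X,
w₀Xw₀⁻¹, kXk⁻¹). The first component controls the entries above the diagonal, the second those
below; if k has no zero entry, the third forces a diagonal X to be scalar. The projected map thus
has kernel of dimension at most 1, is onto by counting dimensions, and A does not vanish on its
image.

Multiplicity one (`finrank_invariants_le_one`). An invariant tensor is an invariant trilinear form L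
on the duals. Take v lowest and u highest in the dual of τ: since v generates under raising
operators that kill u, and u generates under K, L is determined by L(v, u, ·), a torus-invariant
functional on the dual of σ. That space is generated from its lowest weight vector by an abelian
nilradical with independent roots, so words of weight zero all equal the one containing each root
once, and a single number determines L.

The arguments with raising operators need differentials, whereas the K-types are only assumed
continuous. Smoothness comes from η itself: being nonzero, it makes τ and σ quotients of exterior
powers of restrictions of the visibly smooth representation on (𝔤/𝔨̃)³. -/

noncomputable section

namespace RankinSelberg

open Matrix

/-! ### One-parameter subgroups of U(n) -/

section Calculus

open scoped Matrix.Norms.L2Operator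

/-- `s ↦ exp (s X)`, the one-parameter subgroup of `U(n)` with skew-Hermitian generator `X`. -/
def expCurve {n : ℕ} (X : skewAdjoint (Matrix (Fin n) (Fin n) ℂ)) (s : ℝ) : K n :=
  ⟨NormedSpace.exp (s • (X : Matrix (Fin n) (Fin n) ℂ)), by
    have h : (s • X : skewAdjoint (Matrix (Fin n) (Fin n) ℂ)).1 ∈
      skewAdjoint (Matrix (Fin n) (Fin n) ℂ) := (s • X).2
    let : NormedAlgebra ℚ (Matrix (Fin n) (Fin n) ℂ) := NormedAlgebra.restrictScalars ℚ ℝ _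
    exact NormedSpace.exp_mem_unitary_of_mem_skewAdjoint h⟩

variable {n : ℕ}

theorem expCurve_coe (X : skewAdjoint (Matrix (Fin n) (Fin n) ℂ)) (s : ℝ) :
    (expCurve X s).1 = NormedSpace.exp (s • (X : Matrix (Fin n) (Fin n) ℂ)) := rfl

theorem expCurve_zero (X : skewAdjoint (Matrix (Fin n) (Fin n) ℂ)) : expCurve X 0 = 1 :=
  Subtype.ext (by simp [expCurve_coe])

theorem expCurve_add (X : skewAdjoint (Matrix (Fin n) (Fin n) ℂ)) (s t : ℝ) :
    expCurve X (s + t) = expCurve X s * expCurve X t := by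
  refine Subtype.ext ?_
  change _ = (expCurve X s).1 * (expCurve X t).1
  rw [expCurve_coe, expCurve_coe, expCurve_coe, add_smul]
  exact Matrix.exp_add_of_commute _ _ (((Commute.refl _).smul_left s).smul_right t)

theorem expCurve_inv (X : skewAdjoint (Matrix (Fin n) (Fin n) ℂ)) (s : ℝ) :
    (expCurve X s)⁻¹ = expCurve X (-s) := by
  rw [inv_eq_iff_mul_eq_one, ← expCurve_add, add_neg_cancel, expCurve_zero]

theorem hasDerivAt_expCurve_apply (X : skewAdjoint (Matrix (Fin n) (Fin n) ℂ)) (i j : Fin n) :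
    HasDerivAt (fun s => (expCurve X s).1 i j) (X.1 i j) 0 := by
  have h := hasDerivAt_exp_smul_const (𝕂 := ℝ) (X : Matrix (Fin n) (Fin n) ℂ) (0 : ℝ)
  simp only [zero_smul, NormedSpace.exp_zero, one_mul] at h
  let L : Matrix (Fin n) (Fin n) ℂ →ₗ[ℝ] ℂ :=
    { toFun := fun A => A i j, map_add' := fun _ _ => rfl, map_smul' := fun _ _ => rfl }
  exact (LinearMap.toContinuousLinearMap L).hasFDerivAt.comp_hasDerivAt (0 : ℝ) h

/-- Functional calculus gives k = exp(i arg k). The branch cut of arg does no harm, since the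
spectrum is finite and any function is continuous on it. -/
theorem exists_expCurve_eq (k : K n) :
    ∃ X : skewAdjoint (Matrix (Fin n) (Fin n) ℂ), expCurve X 1 = k := by
  have hc : ContinuousOn Complex.arg (spectrum ℂ k.1) := (Matrix.finite_spectrum k.1).continuousOn _
  have hn : IsStarNormal k.1 := inferInstance
  have hs : IsSelfAdjoint (cfc (fun z => (Complex.arg z : ℂ)) k.1) := IsSelfAdjoint.cfc_arg k.1
  refine ⟨⟨Complex.I • cfc (fun z => (Complex.arg z : ℂ)) k.1, ?_⟩, Subtype.ext ?_⟩
  · rw [skewAdjoint.mem_iff, star_smul, hs.star_eq]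
    simp
  · rw [expCurve_coe, one_smul, ← CFC.exp_eq_normedSpace_exp (𝕜 := ℂ), ← cfc_comp_smul ..,
      ← cfc_comp' ..]
    conv_rhs => rw [← cfc_id' ℂ k.1]
    refine cfc_congr fun y hy => ?_
    have hy₁ : ‖y‖ = 1 := spectrum.norm_eq_one_of_unitary k.2 hy
    have : Complex.I * y.arg = Complex.log y :=
      Complex.ext (by simp [Complex.log_re, hy₁]) (by simp [Complex.log_im])
    have hy0 : y ≠ 0 := by rintro rfl; simp at hy₁
    simpa [← Complex.exp_eq_exp_ℂ, this] using Complex.exp_log hy0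

end Calculus

/-! ### Derivatives tested by linear functionals, without a topology on the space -/

section WeakDerivative

variable {V V' U : Type*} [AddCommGroup V] [Module ℂ V] [AddCommGroup V'] [Module ℂ V']
  [AddCommGroup U] [Module ℂ U]

/-- The curve `c` has derivative `c'` at `s`, tested against linear functionals. -/
def HasWeakDerivAt (c : ℝ → V) (c' : V) (s : ℝ) : Prop :=
  ∀ φ : Module.Dual ℂ V, HasDerivAt (fun r => φ (c r)) (φ c') s

theorem HasWeakDerivAt.map {c : ℝ → V} {c' : V} {s : ℝ} (h : HasWeakDerivAt c c' s)
    (f : V →ₗ[ℂ] U) : HasWeakDerivAt (fun r => f (c r)) (f c') s :=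
  fun φ => h (φ ∘ₗ f)

theorem HasWeakDerivAt.congr_deriv {c : ℝ → V} {c' d' : V} {s : ℝ} (h : HasWeakDerivAt c c' s)
    (e : c' = d') : HasWeakDerivAt c d' s := e ▸ h

theorem HasWeakDerivAt.unique {c : ℝ → V} {c' d' : V} {s : ℝ} (h : HasWeakDerivAt c c' s)
    (h' : HasWeakDerivAt c d' s) : c' = d' := by
  rw [← sub_eq_zero, ← Module.forall_dual_apply_eq_zero_iff ℂ]
  intro φ
  rw [map_sub, (h φ).unique (h' φ), sub_self]

theorem hasWeakDerivAt_const (v : V) (s : ℝ) : HasWeakDerivAt (fun _ => v) 0 s :=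
  fun φ => by simpa using hasDerivAt_const s (φ v)

theorem HasWeakDerivAt.bilin [FiniteDimensional ℂ V] (B : V →ₗ[ℂ] V' →ₗ[ℂ] U) {c : ℝ → V}
    {e : ℝ → V'} {c' : V} {e' : V'} {s : ℝ} (hc : HasWeakDerivAt c c' s)
    (he : HasWeakDerivAt e e' s) :
    HasWeakDerivAt (fun r => B (c r) (e r)) (B c' (e s) + B (c s) e') s := by
  intro φ
  let b := Module.finBasis ℂ V
  have key : ∀ v w, φ (B v w) = ∑ i, b.coord i v * φ (B (b i) w) := by
    intro v w
    conv_lhs => rw [← b.sum_repr v]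
    simp only [map_sum, LinearMap.sum_apply, map_smul, LinearMap.smul_apply, smul_eq_mul,
      Module.Basis.coord_apply]
  rw [show (fun r => φ (B (c r) (e r))) = fun r => ∑ i, b.coord i (c r) * φ (B (b i) (e r)) from
    funext fun r => key _ _, map_add, key c', key (c s) e', ← Finset.sum_add_distrib]
  refine HasDerivAt.fun_sum fun i _ => ?_
  exact (hc (b.coord i)).mul (he (φ ∘ₗ B (b i)))

end WeakDerivative

/-! ### Complexification: from skew-Hermitian matrices to all matrices -/

section Skew

variable {n : ℕ} {U : Type*} [AddCommGroup U] [Module ℂ U]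

/-- Skew-Hermitian matrices span 𝔤𝔩ₙ(ℂ) over ℂ. Identities between differentials are proved for
skew-Hermitian X, as derivatives along curves in K, and extended by this lemma. -/
theorem linearMap_ext_skewAdjoint {f g : Matrix (Fin n) (Fin n) ℂ →ₗ[ℂ] U}
    (h : ∀ X : skewAdjoint (Matrix (Fin n) (Fin n) ℂ), f X = g X) : f = g := by
  refine LinearMap.ext fun X => ?_
  have h1 : X - Xᴴ ∈ skewAdjoint (Matrix (Fin n) (Fin n) ℂ) := by
    rw [skewAdjoint.mem_iff, star_sub, ← star_eq_conjTranspose, star_star, neg_sub]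
  have h2 : Complex.I • (X + Xᴴ) ∈ skewAdjoint (Matrix (Fin n) (Fin n) ℂ) := by
    rw [skewAdjoint.mem_iff, star_smul, star_add, ← star_eq_conjTranspose, star_star]
    simp [add_comm]
  have e : X = (1 / 2 : ℂ) • (X - Xᴴ) - (Complex.I / 2) • (Complex.I • (X + Xᴴ)) := by
    rw [smul_smul, div_mul_eq_mul_div, Complex.I_mul_I, smul_sub, smul_add]
    module
  have e1 : f (X - Xᴴ) = g (X - Xᴴ) := h ⟨_, h1⟩
  have e2 : f (Complex.I • (X + Xᴴ)) = g (Complex.I • (X + Xᴴ)) := h ⟨_, h2⟩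
  rw [e, f.map_sub, g.map_sub, f.map_smul, g.map_smul, f.map_smul (Complex.I / 2),
    g.map_smul (Complex.I / 2), e1, e2]

/-- Conjugation of a skew-Hermitian matrix by a unitary matrix. -/
def skewConj (k : K n) (X : skewAdjoint (Matrix (Fin n) (Fin n) ℂ)) :
    skewAdjoint (Matrix (Fin n) (Fin n) ℂ) :=
  ⟨k.1 * X.1 * k.1ᴴ, by
    have h : star X.1 = -X.1 := X.2
    rw [star_eq_conjTranspose] at h
    rw [skewAdjoint.mem_iff, star_eq_conjTranspose]
    simp [Matrix.conjTranspose_mul, h, Matrix.mul_assoc]⟩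

theorem conjTranspose_mul_self (k : K n) : k.1ᴴ * k.1 = 1 := Matrix.mem_unitaryGroup_iff'.1 k.2

theorem mul_conjTranspose_self (k : K n) : k.1 * k.1ᴴ = 1 := Matrix.mem_unitaryGroup_iff.1 k.2

theorem inv_coe (k : K n) : (k⁻¹).1 = k.1ᴴ := rfl

theorem expCurve_skewConj (k : K n) (X : skewAdjoint (Matrix (Fin n) (Fin n) ℂ)) (s : ℝ) :
    expCurve (skewConj k X) s = k * expCurve X s * k⁻¹ := by
  refine Subtype.ext ?_
  change _ = k.1 * (expCurve X s).1 * k.1ᴴ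
  have hk : k.1⁻¹ = k.1ᴴ := Matrix.inv_eq_right_inv (mul_conjTranspose_self k)
  have hu : IsUnit k.1 := by
    rw [Matrix.isUnit_iff_isUnit_det]
    exact (Matrix.isUnit_det_of_right_inverse (mul_conjTranspose_self k))
  rw [expCurve_coe, expCurve_coe, ← hk, ← Matrix.exp_conj _ _ hu, hk]
  congr 1
  simp [skewConj]

end Skew

/-! ### Smooth representations and their differentials -/

section Smooth

variable (n : ℕ)

/-- The functions on `U(n)` possessing a differential at `1`, in the sense that the derivatives
along one-parameter subgroups are given by one complex linear form on `𝔤𝔩ₙ(ℂ)`. -/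
def smoothAtOne : Subalgebra ℂ (K n → ℂ) where
  carrier := {h | ∃ D : Matrix (Fin n) (Fin n) ℂ →ₗ[ℂ] ℂ,
    ∀ X : skewAdjoint (Matrix (Fin n) (Fin n) ℂ),
      HasDerivAt (fun s => h (expCurve X s)) (D X) 0}
  mul_mem' := by
    rintro f g ⟨D, hD⟩ ⟨E, hE⟩
    refine ⟨g 1 • D + f 1 • E, fun X => ?_⟩
    refine ((hD X).mul (hE X)).congr_deriv ?_
    simp only [expCurve_zero, LinearMap.add_apply, LinearMap.smul_apply, smul_eq_mul]
    ring
  add_mem' := by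
    rintro f g ⟨D, hD⟩ ⟨E, hE⟩
    exact ⟨D + E, fun X => (hD X).add (hE X)⟩
  algebraMap_mem' := fun r => ⟨0, fun X => by
    simpa using hasDerivAt_const (0 : ℝ) r⟩

variable {n}

theorem apply_mem_smoothAtOne (i j : Fin n) : (fun k : K n => k.1 i j) ∈ smoothAtOne n :=
  ⟨Matrix.entryLinearMap ℂ ℂ i j, fun X => hasDerivAt_expCurve_apply X i j⟩

theorem inv_mem_smoothAtOne {h : K n → ℂ} (hh : h ∈ smoothAtOne n) :
    (fun k => h k⁻¹) ∈ smoothAtOne n := by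
  obtain ⟨D, hD⟩ := hh
  refine ⟨-D, fun X => ?_⟩
  have h := hD (-X)
  have e : ∀ s, expCurve (-X) s = (expCurve X s)⁻¹ := fun s => by
    rw [expCurve_inv]
    exact Subtype.ext (by simp [expCurve_coe])
  simpa [e] using h

/-- For unitary k, the conjugate of an entry is the transposed entry of k⁻¹. -/
theorem star_apply_mem_smoothAtOne (i j : Fin n) :
    (fun k : K n => star (k.1 i j)) ∈ smoothAtOne n :=
  inv_mem_smoothAtOne (apply_mem_smoothAtOne j i)

variable {V : Type*} [AddCommGroup V] [Module ℂ V]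

/-- All matrix coefficients of `ρ` are smooth at `1`. -/
def IsSmooth (ρ : Representation ℂ (K n) V) : Prop :=
  ∀ (φ : Module.Dual ℂ V) (v : V), (fun k => φ (ρ k v)) ∈ smoothAtOne n

/-- `d` is the complexified differential of `ρ`. -/
def IsDifferential (ρ : Representation ℂ (K n) V)
    (d : Matrix (Fin n) (Fin n) ℂ →ₗ[ℂ] Module.End ℂ V) : Prop :=
  ∀ (X : skewAdjoint (Matrix (Fin n) (Fin n) ℂ)) (v : V),
    HasWeakDerivAt (fun s => ρ (expCurve X s) v) (d X v) 0

theorem IsSmooth.exists_isDifferential [FiniteDimensional ℂ V] {ρ : Representation ℂ (K n) V}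
    (h : IsSmooth ρ) : ∃ d, IsDifferential ρ d := by
  let b := Module.finBasis ℂ V
  choose D hD using fun i j => h (b.coord i) (b j)
  refine ⟨∑ i, ∑ j, (D i j).smulRight ((b.coord j).smulRight (b i)), fun X v φ => ?_⟩
  have key : ∀ k, φ (ρ k v) = ∑ i, ∑ j, b.coord i (ρ k (b j)) * (b.coord j v * φ (b i)) := by
    intro k
    conv_lhs => rw [← b.sum_repr v, map_sum, ← b.sum_repr (∑ i, _)]
    simp only [map_sum, map_smul, smul_eq_mul, Finset.sum_apply', Finsupp.smul_apply, Finset.sum_mul, Module.Basis.coord_apply]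
    refine Finset.sum_congr rfl fun i _ => Finset.sum_congr rfl fun j _ => by ring
  simp only [key, LinearMap.sum_apply, map_sum, LinearMap.smulRight_apply, LinearMap.smul_apply,
    map_smul, smul_eq_mul]
  refine HasDerivAt.fun_sum fun i _ => HasDerivAt.fun_sum fun j _ => ?_
  exact (hD i j X).mul_const _

end Smooth

section Differential

variable {n : ℕ} {V : Type*} [AddCommGroup V] [Module ℂ V] {ρ : Representation ℂ (K n) V}
  {d : Matrix (Fin n) (Fin n) ℂ →ₗ[ℂ] Module.End ℂ V}

/-- Conjugating the one-parameter subgroup of X by k gives that of k X kᴴ, so both sides are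
derivatives of the same curve. -/
theorem IsDifferential.equivariant (h : IsDifferential ρ d) (k : K n)
    (X : Matrix (Fin n) (Fin n) ℂ) (v : V) :
    ρ k (d X v) = d (k.1 * X * k.1ᴴ) (ρ k v) := by
  let c : Matrix (Fin n) (Fin n) ℂ →ₗ[ℂ] Matrix (Fin n) (Fin n) ℂ :=
    LinearMap.mulRight ℂ k.1ᴴ ∘ₗ LinearMap.mulLeft ℂ k.1
  have key : (ρ k ∘ₗ d.flip v) = d.flip (ρ k v) ∘ₗ c := by
    refine linearMap_ext_skewAdjoint fun X => ?_
    refine ((h X v).map (ρ k)).unique ?_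
    refine HasWeakDerivAt.congr_deriv (c' := d (skewConj k X) (ρ k v)) ?_ rfl
    have h2 := h (skewConj k X) (ρ k v)
    simp only [expCurve_skewConj, map_mul, Module.End.mul_apply] at h2
    simpa using h2
  exact LinearMap.congr_fun key X

theorem IsDifferential.hasWeakDerivAt (h : IsDifferential ρ d)
    (X : skewAdjoint (Matrix (Fin n) (Fin n) ℂ)) (v : V) (s : ℝ) :
    HasWeakDerivAt (fun r => ρ (expCurve X r) v) (d X (ρ (expCurve X s) v)) s := by
  intro φ
  have h1 := h X (ρ (expCurve X s) v) φ
  rw [← sub_self s] at h1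
  have h2 := h1.comp_sub_const s s
  refine h2.congr_of_eventuallyEq (Filter.Eventually.of_forall fun r => ?_)
  change _ = φ (ρ _ (ρ _ v))
  rw [← Module.End.mul_apply, ← map_mul, ← expCurve_add, sub_add_cancel]

theorem hasWeakDerivAt_expCurve (X : skewAdjoint (Matrix (Fin n) (Fin n) ℂ)) :
    HasWeakDerivAt (fun s => (expCurve X s).1) X.1 0 := by
  intro φ
  have key : ∀ A, φ A = ∑ i, ∑ j, A i j * φ (Matrix.single i j 1) := by
    intro A
    conv_lhs => rw [Matrix.matrix_eq_sum_single A]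
    simp only [map_sum]
    refine Finset.sum_congr rfl fun i _ => Finset.sum_congr rfl fun j _ => ?_
    rw [← smul_eq_mul, ← map_smul, Matrix.smul_single, smul_eq_mul, mul_one]
  rw [show (fun s => φ (expCurve X s).1) = fun s => ∑ i, ∑ j, (expCurve X s).1 i j *
    φ (Matrix.single i j 1) from funext fun s => key _, key X.1]
  exact HasDerivAt.fun_sum fun i _ => HasDerivAt.fun_sum fun j _ =>
    (hasDerivAt_expCurve_apply X i j).mul_const _

/-- Differentiate the equivariance ρ(k) d(X) v = d(k X kᴴ) ρ(k) v along k = exp(sY). -/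
theorem IsDifferential.bracket [FiniteDimensional ℂ V] (h : IsDifferential ρ d)
    (Y X : Matrix (Fin n) (Fin n) ℂ) (v : V) :
    d Y (d X v) = d (Y * X - X * Y) v + d X (d Y v) := by
  let c : Matrix (Fin n) (Fin n) ℂ →ₗ[ℂ] Matrix (Fin n) (Fin n) ℂ :=
    LinearMap.mulRight ℂ X - LinearMap.mulLeft ℂ X
  have key : d.flip (d X v) = d.flip v ∘ₗ c + d X ∘ₗ d.flip v := by
    refine linearMap_ext_skewAdjoint fun Y => ?_
    refine (h Y (d X v)).unique ?_
    have h0 : HasWeakDerivAt (fun s => (expCurve Y s).1ᴴ) (-Y.1) 0 := by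
      have h1 := hasWeakDerivAt_expCurve (-Y)
      have e : ∀ s, (expCurve (-Y) s).1 = (expCurve Y s).1ᴴ := fun s => by
        rw [← inv_coe, expCurve_inv]
        simp [expCurve_coe]
      simpa [e] using h1
    have h1 := ((hasWeakDerivAt_expCurve Y).map (LinearMap.mulRight ℂ X)).bilin
      (LinearMap.mul ℂ (Matrix (Fin n) (Fin n) ℂ)) h0
    have h2 := h1.bilin d (h Y v)
    have e : (fun s => ρ (expCurve Y s) (d X v)) = fun r =>
      (d (((LinearMap.mul ℂ (Matrix (Fin n) (Fin n) ℂ)) ((LinearMap.mulRight ℂ X)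
        (expCurve Y r).1)) ((expCurve Y r).1)ᴴ)) ((ρ (expCurve Y r)) v) :=
      funext fun s => h.equivariant _ _ _
    rw [e]
    refine h2.congr_deriv ?_
    simp [expCurve_zero, c, sub_eq_add_neg]
  exact LinearMap.congr_fun key Y

/-- Write k = exp X. The annihilator of S is stable under the transpose of d(X), so the values on
ρ(exp sX) v of a basis of the annihilator solve a linear ODE with initial value 0. By uniqueness
they vanish for all s, in particular at s = 1. -/
theorem IsDifferential.stable [FiniteDimensional ℂ V] (h : IsDifferential ρ d)
    {S : Submodule ℂ V} (hS : ∀ X, ∀ v ∈ S, d X v ∈ S) (k : K n) {v : V} (hv : v ∈ S) :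
    ρ k v ∈ S := by
  obtain ⟨X, rfl⟩ := exists_expCurve_eq k
  let b := Module.finBasis ℂ S.dualAnnihilator
  let A : S.dualAnnihilator →ₗ[ℂ] S.dualAnnihilator :=
    ((d X.1).dualMap).restrict fun φ hφ => by
      rw [Submodule.mem_dualAnnihilator] at hφ ⊢
      exact fun w hw => hφ _ (hS _ _ hw)
  have hb : ∀ x : S.dualAnnihilator, x.1 = ∑ j, b.repr x j • (b j).1 := fun x => by
    have hx := congrArg S.dualAnnihilator.subtype (b.sum_repr x)
    simp only [map_sum, map_smul, Submodule.subtype_apply] at hx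
    exact hx.symm
  let M := LinearMap.toMatrix b b A
  let y : ℝ → Fin (Module.finrank ℂ S.dualAnnihilator) → ℂ :=
    fun s i => (b i).1 (ρ (expCurve X s) v)
  let G : (Fin (Module.finrank ℂ S.dualAnnihilator) → ℂ) →L[ℂ]
    (Fin (Module.finrank ℂ S.dualAnnihilator) → ℂ) := LinearMap.toContinuousLinearMap (Mᵀ).mulVecLin
  have hy : ∀ s, HasDerivAt y (G (y s)) s := by
    intro s
    rw [hasDerivAt_pi]
    intro i
    refine (h.hasWeakDerivAt X v s (b i).1).congr_deriv ?_
    have e : (A (b i)).1 = ∑ j, M j i • (b j).1 := by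
      simp only [M, LinearMap.toMatrix_apply]
      exact hb _
    have e2 : (b i).1 (d X.1 (ρ (expCurve X s) v)) = (A (b i)).1 (ρ (expCurve X s) v) := rfl
    rw [e2, e]
    simp [G, Matrix.vecMul, dotProduct, y, mul_comm]
  have h0 : ∀ s, HasDerivAt (0 : ℝ → Fin (Module.finrank ℂ S.dualAnnihilator) → ℂ)
      (G ((0 : ℝ → Fin (Module.finrank ℂ S.dualAnnihilator) → ℂ) s)) s := by
    intro s
    simp
  have hy0 : y 0 = 0 := by
    funext i
    simp [y, expCurve_zero, (Submodule.mem_dualAnnihilator _).1 (b i).2 v hv]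
  have key : y = 0 := ODE_solution_unique_univ (v := fun _ => G) (s := fun _ => Set.univ) (t₀ := 0)
    (fun _ => G.lipschitz.lipschitzOnWith) (fun s => ⟨hy s, trivial⟩)
    (fun s => ⟨h0 s, trivial⟩) hy0
  rw [← Subspace.dualAnnihilator_dualCoannihilator_eq (W := S), Submodule.mem_dualCoannihilator]
  intro φ hφ
  have e : φ = ∑ i, b.repr ⟨φ, hφ⟩ i • (b i).1 := hb ⟨φ, hφ⟩
  have hz : ∀ i, (b i).1 (ρ (expCurve X 1) v) = 0 := fun i => congrFun (congrFun key 1) i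
  rw [e]
  simp [hz]

end Differential

/-! ### Weights of the diagonal torus -/

section Weights

variable {n : ℕ}

/-- The character `t ↦ t₁^μ₁ ⋯ tₙ^μₙ` of the torus. -/
def weightChar (μ : Fin n → ℤ) (t : Fin n → Circle) : ℂ := ∏ i, (t i : ℂ) ^ μ i

theorem weightChar_add (μ ν : Fin n → ℤ) (t : Fin n → Circle) :
    weightChar (μ + ν) t = weightChar μ t * weightChar ν t := by
  simp only [weightChar, Pi.add_apply, ← Finset.prod_mul_distrib]
  exact Finset.prod_congr rfl fun i _ => zpow_add₀ (Circle.coe_ne_zero _) _ _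

theorem weightChar_zero (t : Fin n → Circle) : weightChar 0 t = 1 := by simp [weightChar]

theorem weightChar_neg_mul (μ : Fin n → ℤ) (t : Fin n → Circle) :
    weightChar (-μ) t * weightChar μ t = 1 := by
  rw [← weightChar_add, neg_add_cancel, weightChar_zero]

theorem weightChar_mul (μ : Fin n → ℤ) (s t : Fin n → Circle) :
    weightChar μ (s * t) = weightChar μ s * weightChar μ t := by
  simp only [weightChar, Pi.mul_apply, Circle.coe_mul, mul_zpow, Finset.prod_mul_distrib]

theorem weightChar_inv (μ : Fin n → ℤ) (t : Fin n → Circle) :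
    weightChar μ t⁻¹ = weightChar (-μ) t := by
  simp [weightChar]

theorem weightChar_single (i : Fin n) (t : Fin n → Circle) :
    weightChar (Pi.single i 1) t = t i := by
  rw [weightChar, Finset.prod_eq_single i] <;> simp +contextual

theorem weightChar_sum {κ : Type*} (s : Finset κ) (μ : κ → Fin n → ℤ) (t : Fin n → Circle) :
    weightChar (∑ i ∈ s, μ i) t = ∏ i ∈ s, weightChar (μ i) t := by
  classical
  induction s using Finset.induction_on with
  | empty => simp [weightChar_zero]
  | insert a s ha ih => rw [Finset.sum_insert ha, Finset.prod_insert ha, weightChar_add, ih]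

theorem continuous_circle_coe : Continuous ((↑) : Circle → ℂ) := continuous_subtype_val

theorem continuous_weightChar (μ : Fin n → ℤ) : Continuous (weightChar μ) :=
  continuous_finsetProd _ fun i _ => (continuous_circle_coe.comp (continuous_apply i)).zpow₀ _
    fun _ => Or.inl (Circle.coe_ne_zero _)

/-- exp(i) is not a root of unity, because π is irrational. One element of the circle therefore
separates all integer exponents. -/
theorem zpow_circleExp_one_injective {a b : ℤ}
    (h : ((Circle.exp 1 : Circle) : ℂ) ^ a = ((Circle.exp 1 : Circle) : ℂ) ^ b) : a = b := by
  rw [← Circle.coe_zpow, ← Circle.coe_zpow, ← Circle.exp_zsmul, ← Circle.exp_zsmul] at h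
  obtain ⟨m, hm⟩ := Circle.exp_eq_exp.1 (Circle.coe_injective h)
  by_contra hab
  have hm0 : m ≠ 0 := by
    rintro rfl
    apply hab
    simpa using hm
  refine irrational_pi.ne_rat ((a - b : ℤ) / (2 * m : ℤ) : ℚ) ?_
  have : (m : ℝ) ≠ 0 := by exact_mod_cast hm0
  push_cast
  field_simp
  simp only [zsmul_eq_mul, mul_one] at hm
  linarith

theorem weightChar_circleExp (μ h : Fin n → ℤ) :
    weightChar μ (fun i => Circle.exp 1 ^ h i) = (Circle.exp 1 : ℂ) ^ (∑ i, h i * μ i) := by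
  simp only [weightChar, Circle.coe_zpow, ← _root_.zpow_mul]
  induction (Finset.univ : Finset (Fin n)) using Finset.induction_on with
  | empty => simp
  | insert a s ha ih =>
    rw [Finset.sum_insert ha, Finset.prod_insert ha, ih, zpow_add₀ (Circle.coe_ne_zero _)]

theorem weightChar_injective {μ ν : Fin n → ℤ} (h : ∀ t, weightChar μ t = weightChar ν t) :
    μ = ν := by
  funext i
  have h1 := h fun j => Circle.exp 1 ^ (Pi.single i 1 : Fin n → ℤ) j
  rw [weightChar_circleExp, weightChar_circleExp] at h1
  simpa [Pi.single_apply] using zpow_circleExp_one_injective h1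

theorem diagTorus_mul (s t : Fin n → Circle) :
    diagTorus (s * t) = diagTorus s * diagTorus t := by
  refine Subtype.ext ?_
  change Matrix.diagonal _ = Matrix.diagonal _ * Matrix.diagonal _
  simp [Matrix.diagonal_mul_diagonal]

theorem diagTorus_one : diagTorus (1 : Fin n → Circle) = 1 := by
  refine Subtype.ext ?_
  change Matrix.diagonal _ = 1
  simp

theorem diagTorus_inv (t : Fin n → Circle) : diagTorus t⁻¹ = (diagTorus t)⁻¹ := by
  rw [eq_inv_iff_mul_eq_one, ← diagTorus_mul, inv_mul_cancel, diagTorus_one]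

theorem continuous_diagTorus : Continuous (diagTorus : (Fin n → Circle) → K n) := by
  refine Continuous.subtype_mk ?_ _
  exact Continuous.matrix_diagonal
    (continuous_pi fun i => continuous_circle_coe.comp (continuous_apply i))

variable {V : Type*} [AddCommGroup V] [Module ℂ V]

/-- The torus acts on `v` through the character `μ`. -/
def HasWeight (ρ : Representation ℂ (K n) V) (μ : Fin n → ℤ) (v : V) : Prop :=
  ∀ t : Fin n → Circle, ρ (diagTorus t) v = weightChar μ t • v

variable {ρ : Representation ℂ (K n) V}

/-- Average a functional with f₀(v) ≠ 0 over the compact torus against the inverse character. The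
integrand is constant on v, so the average remains nonzero there. -/
theorem exists_dual_hasWeight (hρ : ∀ (φ : Module.Dual ℂ V) (v : V), Continuous fun k => φ (ρ k v))
    {μ : Fin n → ℤ} {v : V} (hv : v ≠ 0) (hμ : HasWeight ρ μ v) :
    ∃ f : Module.Dual ℂ V, f v ≠ 0 ∧
      ∀ t w, f (ρ (diagTorus t) w) = weightChar μ t * f w := by
  obtain ⟨f₀, hf₀⟩ : ∃ f : Module.Dual ℂ V, f v ≠ 0 := by
    by_contra! h
    exact hv ((Module.forall_dual_apply_eq_zero_iff ℂ v).1 h)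
  let : MeasurableSpace (Fin n → Circle) := borel _
  have : BorelSpace (Fin n → Circle) := ⟨rfl⟩
  let m : MeasureTheory.Measure (Fin n → Circle) := MeasureTheory.Measure.haar
  have hc : ∀ w, Continuous fun t => weightChar (-μ) t * f₀ (ρ (diagTorus t) w) := fun w =>
    (continuous_weightChar _).mul ((hρ f₀ w).comp continuous_diagTorus)
  have hi : ∀ w, MeasureTheory.Integrable
      (fun t => weightChar (-μ) t * f₀ (ρ (diagTorus t) w)) m := fun w =>
    (hc w).integrable_of_hasCompactSupport (HasCompactSupport.of_compactSpace _)
  refine ⟨{ toFun := fun w => ∫ t, weightChar (-μ) t * f₀ (ρ (diagTorus t) w) ∂m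
            map_add' := fun w w' => ?_
            map_smul' := fun a w => ?_ }, ?_, ?_⟩
  · rw [← MeasureTheory.integral_add (hi w) (hi w')]
    simp [mul_add]
  · rw [RingHom.id_apply, smul_eq_mul, ← MeasureTheory.integral_const_mul]
    simp [mul_left_comm]
  · have e : ∀ t, weightChar (-μ) t * f₀ (ρ (diagTorus t) v) = f₀ v := fun t => by
      rw [hμ t, map_smul, smul_eq_mul, ← mul_assoc, weightChar_neg_mul, one_mul]
    change ∫ t, weightChar (-μ) t * f₀ (ρ (diagTorus t) v) ∂m ≠ 0
    simp only [e]
    rw [MeasureTheory.integral_const, smul_ne_zero_iff]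
    refine ⟨?_, hf₀⟩
    rw [MeasureTheory.Measure.real, ENNReal.toReal_ne_zero]
    exact ⟨(MeasureTheory.Measure.measure_univ_pos.2 (NeZero.ne m)).ne',
      MeasureTheory.measure_ne_top _ _⟩
  · intro t w
    change ∫ s, weightChar (-μ) s * f₀ (ρ (diagTorus s) (ρ (diagTorus t) w)) ∂m =
      weightChar μ t * ∫ s, weightChar (-μ) s * f₀ (ρ (diagTorus s) w) ∂m
    rw [← MeasureTheory.integral_const_mul,
      ← MeasureTheory.integral_mul_right_eq_self (μ := m)
        (fun s => weightChar μ t * (weightChar (-μ) s * f₀ (ρ (diagTorus s) w))) t]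
    refine MeasureTheory.integral_congr_ae (Filter.Eventually.of_forall fun s => ?_)
    dsimp only
    rw [weightChar_mul, diagTorus_mul, map_mul, Module.End.mul_apply]
    have := weightChar_neg_mul μ t
    linear_combination (-weightChar (-μ) s * f₀ (ρ (diagTorus s) (ρ (diagTorus t) w))) * this

theorem continuous_dual [FiniteDimensional ℂ V]
    (hρ : ∀ (φ : Module.Dual ℂ V) (v : V), Continuous fun k => φ (ρ k v))
    (F : Module.Dual ℂ (Module.Dual ℂ V)) (f : Module.Dual ℂ V) :
    Continuous fun k => F (ρ.dual k f) := by
  obtain ⟨v, rfl⟩ := (Module.evalEquiv ℂ V).surjective F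
  exact (hρ f v).comp continuous_inv

theorem IsWeight.of_dual [FiniteDimensional ℂ V]
    (hρ : ∀ (φ : Module.Dual ℂ V) (v : V), Continuous fun k => φ (ρ k v))
    {μ : Fin n → ℤ} (h : IsWeight ρ.dual μ) : IsWeight ρ (-μ) := by
  obtain ⟨f, hf, hμ⟩ := h
  obtain ⟨F, hF, hFμ⟩ := exists_dual_hasWeight (continuous_dual hρ) hf hμ
  obtain ⟨v, rfl⟩ := (Module.evalEquiv ℂ V).surjective F
  refine ⟨v, ?_, fun t => ?_⟩
  · rintro rfl
    simp at hF
  · change _ = weightChar (-μ) t • v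
    rw [← sub_eq_zero, ← Module.forall_dual_apply_eq_zero_iff ℂ]
    intro φ
    have h1 := hFμ t⁻¹ φ
    rw [weightChar_inv, diagTorus_inv] at h1
    simp only [Representation.dual_apply, inv_inv, Module.evalEquiv_apply,
      Module.Dual.eval_apply] at h1
    change φ (ρ (diagTorus t) v) = _ at h1
    rw [map_sub, h1, map_smul, smul_eq_mul, sub_self]

/-- The permutation matrix of `π`. -/
def permK (π : Equiv.Perm (Fin n)) : K n :=
  ⟨π.permMatrix ℂ, by
    rw [Matrix.mem_unitaryGroup_iff, Matrix.star_eq_conjTranspose,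
      Matrix.conjTranspose_permMatrix, ← Matrix.permMatrix_mul]
    simp⟩

theorem permK_conj (π : Equiv.Perm (Fin n)) (X : Matrix (Fin n) (Fin n) ℂ) :
    (permK π).1 * X * (permK π).1ᴴ = X.submatrix π π := by
  change π.permMatrix ℂ * X * (π.permMatrix ℂ)ᴴ = _
  rw [Matrix.conjTranspose_permMatrix, PEquiv.toMatrix_toPEquiv_mul, PEquiv.mul_toMatrix_toPEquiv]
  rfl

theorem permK_mul_diagTorus (π : Equiv.Perm (Fin n)) (t : Fin n → Circle) :
    permK π * diagTorus t = diagTorus (t ∘ π) * permK π := by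
  rw [← mul_inv_eq_iff_eq_mul]
  refine Subtype.ext ?_
  change (permK π).1 * Matrix.diagonal _ * (permK π).1ᴴ = Matrix.diagonal _
  rw [permK_conj, Matrix.submatrix_diagonal _ _ π.injective]
  rfl

theorem HasWeight.permK {μ : Fin n → ℤ} {v : V} (h : HasWeight ρ μ v)
    (π : Equiv.Perm (Fin n)) : HasWeight ρ (μ ∘ π) (ρ (permK π) v) := by
  intro t
  have h1 := permK_mul_diagTorus π (t ∘ π.symm)
  have h2 : (t ∘ π.symm) ∘ π = t := by ext; simp
  rw [h2] at h1
  rw [← Module.End.mul_apply, ← map_mul, ← h1, map_mul, Module.End.mul_apply, h, map_smul]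
  congr 1
  simp only [weightChar, Function.comp_apply]
  rw [← Equiv.prod_comp π]
  simp

variable {d : Matrix (Fin n) (Fin n) ℂ →ₗ[ℂ] Module.End ℂ V}

theorem HasWeight.single (hd : IsDifferential ρ d) {μ : Fin n → ℤ} {v : V} (h : HasWeight ρ μ v)
    (i j : Fin n) :
    HasWeight ρ (μ + (Pi.single i 1 - Pi.single j 1)) (d (Matrix.single i j 1) v) := by
  intro t
  have e : (diagTorus t).1 * Matrix.single i j 1 * (diagTorus t).1ᴴ =
      weightChar (Pi.single i 1 - Pi.single j 1) t • Matrix.single i j (1 : ℂ) := by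
    change Matrix.diagonal _ * _ * (Matrix.diagonal _)ᴴ = _
    rw [sub_eq_add_neg, weightChar_add, ← weightChar_inv, weightChar_single, weightChar_single]
    rw [Matrix.diagonal_conjTranspose]
    ext a b
    rw [Matrix.mul_diagonal, Matrix.diagonal_mul, Matrix.smul_apply, Matrix.single_apply]
    split_ifs with hab
    · obtain ⟨rfl, rfl⟩ := hab
      rw [Pi.inv_apply, Circle.coe_inv_eq_conj]
      simp
    · simp
  rw [hd.equivariant, e, h t, map_smul, map_smul, weightChar_add, mul_smul]
  rfl

/-- E_ii is not skew-Hermitian, but i E_ii is, and it exponentiates into the torus, where the action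
on v is explicit. -/
theorem HasWeight.single_self (hd : IsDifferential ρ d) {μ : Fin n → ℤ} {v : V}
    (h : HasWeight ρ μ v) (i : Fin n) : d (Matrix.single i i 1) v = (μ i : ℂ) • v := by
  have hX : Matrix.single i i Complex.I ∈ skewAdjoint (Matrix (Fin n) (Fin n) ℂ) := by
    rw [skewAdjoint.mem_iff, Matrix.star_eq_conjTranspose, Matrix.conjTranspose_single]
    simp [← Matrix.single_neg]
  have h1 := hd ⟨_, hX⟩ v
  have e : ∀ s : ℝ, expCurve ⟨_, hX⟩ s = diagTorus (Pi.mulSingle i (Circle.exp s)) := by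
    intro s
    refine Subtype.ext ?_
    rw [expCurve_coe]
    change _ = Matrix.diagonal _
    change NormedSpace.exp (s • Matrix.single i i Complex.I) = _
    rw [← Matrix.diagonal_single, ← Matrix.diagonal_smul, Matrix.exp_diagonal]
    congr 1
    funext j
    rw [Pi.coe_exp, ← Complex.exp_eq_exp_ℂ]
    by_cases hj : j = i
    · subst hj; simp [Circle.coe_exp]
    · simp [hj]
  have h2 : HasWeakDerivAt (fun s => ρ (expCurve ⟨_, hX⟩ s) v) ((μ i * Complex.I) • v) 0 := by
    intro φ
    have e2 : ∀ s : ℝ, φ (ρ (expCurve ⟨_, hX⟩ s) v) =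
        Complex.exp ((μ i * Complex.I) * s) * φ v := by
      intro s
      rw [e, h, map_smul, smul_eq_mul, weightChar, Finset.prod_eq_single i]
      · rw [Pi.mulSingle_eq_same, Circle.coe_exp, ← Complex.exp_int_mul]
        congr 2; ring
      · intro j _ hj
        simp [Pi.mulSingle_eq_of_ne hj]
      · simp
    simp only [e2, map_smul, smul_eq_mul]
    have h3 : HasDerivAt (fun s : ℝ => Complex.exp ((μ i * Complex.I) * s))
        (μ i * Complex.I) 0 := by
      have h4 : HasDerivAt (fun s : ℝ => (μ i * Complex.I) * (s : ℂ)) (μ i * Complex.I) 0 := by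
        simpa using (Complex.ofRealCLM.hasDerivAt (x := (0 : ℝ))).const_mul (μ i * Complex.I)
      simpa using h4.cexp
    exact h3.mul_const _
  have h3 := h1.unique h2
  have e3 : Matrix.single i i Complex.I = Complex.I • Matrix.single i i (1 : ℂ) := by
    simp [Matrix.smul_single]
  simp only at h3
  rw [e3, map_smul, LinearMap.smul_apply, mul_comm, mul_smul] at h3
  exact smul_right_injective V Complex.I_ne_zero h3

end Weights

/-! ### Generating irreducible representations by few operators -/

section Generation

variable {n : ℕ} {V : Type*} [AddCommGroup V] [Module ℂ V] {ρ : Representation ℂ (K n) V}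
  {d : Matrix (Fin n) (Fin n) ℂ →ₗ[ℂ] Module.End ℂ V}

theorem eq_top_of_stable (hρ : ρ.IsIrreducible) {S : Submodule ℂ V}
    (hS : ∀ k, ∀ v ∈ S, ρ k v ∈ S) {v : V} (hv : v ≠ 0) (hvS : v ∈ S) : S = ⊤ := by
  let S' : Subrepresentation ρ := ⟨S, fun k v hv => hS k v hv⟩
  rcases hρ.eq_bot_or_eq_top S' with h | h
  · have : v ∈ S' := hvS
    rw [h] at this
    exact absurd this hv
  · exact congrArg Subrepresentation.toSubmodule h

/-- If every matrix unit acts on `v` by a scalar or belongs to `Y`, then `v` generates the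
irreducible representation under the operators from `Y` alone. -/
theorem eq_top_of_generated [FiniteDimensional ℂ V] (hρ : ρ.IsIrreducible)
    (hd : IsDifferential ρ d) (Y : Fin n → Fin n → Prop) {v : V} (hv : v ≠ 0)
    (hY : ∀ i j, Y i j ∨ ∃ c : ℂ, d (Matrix.single i j 1) v = c • v) {Q : Submodule ℂ V}
    (hvQ : v ∈ Q) (hQ : ∀ i j, Y i j → ∀ w ∈ Q, d (Matrix.single i j 1) w ∈ Q) : Q = ⊤ := by
  let S : Submodule ℂ V := sInf {Q | v ∈ Q ∧
    ∀ i j, Y i j → ∀ w ∈ Q, d (Matrix.single i j 1) w ∈ Q}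
  have hvS : v ∈ S := Submodule.mem_sInf.2 fun Q hQ => hQ.1
  have hSY : ∀ i j, Y i j → ∀ w ∈ S, d (Matrix.single i j 1) w ∈ S := fun i j hij w hw =>
    Submodule.mem_sInf.2 fun Q hQ => hQ.2 i j hij w (Submodule.mem_sInf.1 hw Q hQ)
  -- S is the smallest candidate for Q. The vectors of S that every d(X) keeps in S contain v and,
  -- by the bracket relation, are stable under the operators from Y. By minimality S is stable under
  -- all of 𝔤𝔩ₙ, hence under K.
  let S' : Submodule ℂ V :=
    { carrier := {w | w ∈ S ∧ ∀ X, d X w ∈ S}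
      zero_mem' := ⟨S.zero_mem, fun X => by simp⟩
      add_mem' := fun ha hb => ⟨S.add_mem ha.1 hb.1, fun X => by
        rw [map_add]; exact S.add_mem (ha.2 X) (hb.2 X)⟩
      smul_mem' := fun c a ha => ⟨S.smul_mem c ha.1, fun X => by
        rw [map_smul]; exact S.smul_mem c (ha.2 X)⟩ }
  have hSS' : S ≤ S' := by
    refine sInf_le ⟨⟨hvS, fun X => ?_⟩, fun i j hij w hw => ⟨hSY i j hij w hw.1, fun X => ?_⟩⟩
    · rw [Matrix.matrix_eq_sum_single X]
      simp only [map_sum, LinearMap.sum_apply]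
      refine S.sum_mem fun i _ => S.sum_mem fun j _ => ?_
      have e : Matrix.single i j (X i j) = X i j • Matrix.single i j (1 : ℂ) := by
        simp [Matrix.smul_single]
      rw [e, map_smul]
      refine S.smul_mem _ ?_
      rcases hY i j with h | ⟨c, hc⟩
      · exact hSY i j h v hvS
      · rw [hc]; exact S.smul_mem c hvS
    · rw [hd.bracket]
      exact S.add_mem (hw.2 _) (hSY i j hij _ (hw.2 X))
  have hST : S = ⊤ :=
    eq_top_of_stable hρ (fun k w hw => hd.stable (fun X w hw => (hSS' hw).2 X) k hw) hv hvS
  exact top_le_iff.1 (hST ▸ sInf_le ⟨hvQ, hQ⟩)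

end Generation

/-! ### Detecting tensors by products of functionals and their translates -/

section Contraction

variable {V U W : Type*} [AddCommGroup V] [Module ℂ V] [AddCommGroup U] [Module ℂ U]
  [AddCommGroup W] [Module ℂ W]

/-- Contraction of the left tensor factor with a linear functional. -/
def contrL : Module.Dual ℂ V →ₗ[ℂ] V ⊗[ℂ] U →ₗ[ℂ] U :=
  (TensorProduct.lid ℂ U).toLinearMap.compRight ℂ ∘ₗ LinearMap.rTensorHom U

@[simp]
theorem contrL_tmul (f : Module.Dual ℂ V) (v : V) (u : U) :
    contrL f (v ⊗ₜ[ℂ] u) = f v • u := by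
  simp [contrL]

theorem contrL_map (f : Module.Dual ℂ V) (A : V →ₗ[ℂ] V) (B : U →ₗ[ℂ] U) (t : V ⊗[ℂ] U) :
    contrL f (TensorProduct.map A B t) = B (contrL (f ∘ₗ A) t) := by
  induction t with
  | zero => simp
  | add x y hx hy => simp [hx, hy]
  | tmul x y => simp

theorem eq_zero_of_contrL [FiniteDimensional ℂ V] {t : V ⊗[ℂ] U}
    (h : ∀ f : Module.Dual ℂ V, contrL f t = 0) : t = 0 := by
  let b := Module.finBasis ℂ V
  have key : ∀ t : V ⊗[ℂ] U, t = ∑ i, b i ⊗ₜ[ℂ] contrL (b.coord i) t := by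
    intro t
    induction t with
    | zero => simp
    | add x y hx hy =>
      conv_lhs => rw [hx, hy]
      simp [TensorProduct.tmul_add, Finset.sum_add_distrib]
    | tmul x y =>
      simp only [contrL_tmul, TensorProduct.tmul_smul, TensorProduct.smul_tmul',
        ← TensorProduct.sum_tmul, Module.Basis.coord_apply, b.sum_repr]
  rw [key t]
  simp [h]

/-- The trilinear contraction of `V ⊗ (U ⊗ W)`. -/
def tri (f : Module.Dual ℂ V) (f' : Module.Dual ℂ U) (g : Module.Dual ℂ W) :
    V ⊗[ℂ] (U ⊗[ℂ] W) →ₗ[ℂ] ℂ :=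
  g ∘ₗ contrL f' ∘ₗ contrL f

theorem tri_apply (f : Module.Dual ℂ V) (f' : Module.Dual ℂ U) (g : Module.Dual ℂ W)
    (t : V ⊗[ℂ] (U ⊗[ℂ] W)) : tri f f' g t = g (contrL f' (contrL f t)) := rfl

theorem tri_map (f : Module.Dual ℂ V) (f' : Module.Dual ℂ U) (g : Module.Dual ℂ W)
    (A : V →ₗ[ℂ] V) (B : U →ₗ[ℂ] U) (C : W →ₗ[ℂ] W) (t : V ⊗[ℂ] (U ⊗[ℂ] W)) :
    tri f f' g (TensorProduct.map A (TensorProduct.map B C) t) =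
      tri (f ∘ₗ A) (f' ∘ₗ B) (g ∘ₗ C) t := by
  simp only [tri_apply, contrL_map, LinearMap.comp_apply]

theorem eq_zero_of_tri [FiniteDimensional ℂ V] [FiniteDimensional ℂ U]
    {t : V ⊗[ℂ] (U ⊗[ℂ] W)} (h : ∀ f f' g, tri f f' g t = 0) : t = 0 :=
  eq_zero_of_contrL fun f => eq_zero_of_contrL fun f' =>
    (Module.forall_dual_apply_eq_zero_iff ℂ _).1 fun g => h f f' g

end Contraction

section Dual

variable {G V : Type*} [Group G] [AddCommGroup V] [Module ℂ V] {ρ : Representation ℂ G V}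

theorem dual_apply_apply (k : G) (f : Module.Dual ℂ V) : ρ.dual k f = f ∘ₗ ρ k⁻¹ := rfl

theorem IsIrreducible.dual [FiniteDimensional ℂ V] (hρ : ρ.IsIrreducible) :
    ρ.dual.IsIrreducible := by
  have hnt : Nontrivial V := by
    by_contra h
    rw [not_nontrivial_iff_subsingleton] at h
    refine hρ.toNontrivial.exists_pair_ne.elim fun A ⟨B, hAB⟩ => hAB ?_
    exact Subrepresentation.toSubmodule_injective (Subsingleton.elim _ _)
  refine { exists_pair_ne := ⟨⊥, ⊤, fun h => ?_⟩, eq_bot_or_eq_top := fun S => ?_ }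
  · have h1 : (⊥ : Submodule ℂ (Module.Dual ℂ V)) = ⊤ :=
      congrArg Subrepresentation.toSubmodule h
    exact bot_ne_top h1
  · let T : Subrepresentation ρ := ⟨S.toSubmodule.dualCoannihilator, fun k v hv => by
      rw [Submodule.mem_dualCoannihilator] at hv ⊢
      intro φ hφ
      have h1 := hv _ (S.apply_mem_toSubmodule k⁻¹ hφ)
      rw [dual_apply_apply, inv_inv] at h1
      exact h1⟩
    have hS : S.toSubmodule.dualCoannihilator.dualAnnihilator = S.toSubmodule :=
      Subspace.dualCoannihilator_dualAnnihilator_eq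
    rcases hρ.eq_bot_or_eq_top T with h | h
    · right
      refine Subrepresentation.toSubmodule_injective ?_
      have h1 : S.toSubmodule.dualCoannihilator = ⊥ := congrArg Subrepresentation.toSubmodule h
      rw [← hS, h1, Submodule.dualAnnihilator_bot]
      rfl
    · left
      refine Subrepresentation.toSubmodule_injective ?_
      have h1 : S.toSubmodule.dualCoannihilator = ⊤ := congrArg Subrepresentation.toSubmodule h
      rw [← hS, h1, Submodule.dualAnnihilator_top]
      rfl

end Dual

section Translates

variable {n : ℕ} {V U W : Type*} [AddCommGroup V] [Module ℂ V] [AddCommGroup U] [Module ℂ U]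
  [AddCommGroup W] [Module ℂ W] {ρ : Representation ℂ (K n) V} {τ : Representation ℂ (K n) U}
  {σ : Representation ℂ (K n) W}

/-- The functionals all of whose translates contract t to zero form a subrepresentation of the
irreducible dual; if f belonged to it, every contraction of t would vanish. -/
theorem exists_contrL_ne_zero [FiniteDimensional ℂ V] (hρ : ρ.IsIrreducible)
    {f : Module.Dual ℂ V} (hf : f ≠ 0) {t : V ⊗[ℂ] U} (ht : t ≠ 0) :
    ∃ k, contrL (f ∘ₗ ρ k) t ≠ 0 := by
  by_contra! h
  refine ht (eq_zero_of_contrL fun f' => ?_)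
  let S : Submodule ℂ (Module.Dual ℂ V) :=
    { carrier := {φ | ∀ k, contrL (φ ∘ₗ ρ k) t = 0}
      zero_mem' := fun k => by simp
      add_mem' := fun ha hb k => by
        rw [LinearMap.add_comp, map_add, LinearMap.add_apply, ha k, hb k, add_zero]
      smul_mem' := fun c a ha k => by
        rw [LinearMap.smul_comp, map_smul, LinearMap.smul_apply, ha k, smul_zero] }
  have hS : S = ⊤ := by
    refine eq_top_of_stable (IsIrreducible.dual hρ) (fun k φ hφ l => ?_) hf h
    rw [dual_apply_apply, LinearMap.comp_assoc, ← Module.End.mul_eq_comp, ← map_mul]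
    exact hφ _
  have h1 : f' ∈ S := hS ▸ Submodule.mem_top
  simpa [Module.End.one_eq_id, LinearMap.comp_id] using h1 1

theorem exists_tri_ne_zero [FiniteDimensional ℂ V] [FiniteDimensional ℂ U]
    [FiniteDimensional ℂ W] (hρ : ρ.IsIrreducible) (hτ : τ.IsIrreducible) (hσ : σ.IsIrreducible)
    {f : Module.Dual ℂ V} (hf : f ≠ 0) {f' : Module.Dual ℂ U} (hf' : f' ≠ 0)
    {g : Module.Dual ℂ W} (hg : g ≠ 0) {t : V ⊗[ℂ] (U ⊗[ℂ] W)} (ht : t ≠ 0) :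
    ∃ k l m, tri f f' g
      (TensorProduct.map (ρ k) (TensorProduct.map (τ l) (σ m)) t) ≠ 0 := by
  obtain ⟨k, hk⟩ := exists_contrL_ne_zero hρ hf ht
  obtain ⟨l, hl⟩ := exists_contrL_ne_zero hτ hf' hk
  -- The last factor is padded to W ⊗ ℂ so that the contraction lemma applies once more.
  have hw : (contrL (f' ∘ₗ τ l) (contrL (f ∘ₗ ρ k) t)) ⊗ₜ[ℂ] (1 : ℂ) ≠ 0 := fun h =>
    hl (by simpa using congrArg (TensorProduct.rid ℂ W) h)
  obtain ⟨m, hm⟩ := exists_contrL_ne_zero hσ hg hw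
  refine ⟨k, l, m, fun h => hm ?_⟩
  rw [tri_map, tri_apply] at h
  rw [contrL_tmul, h, zero_smul]

end Translates

/-! ### Smoothness of quotients, duals and exterior powers -/

section SmoothConstructions

variable {n : ℕ} {V U W : Type*} [AddCommGroup V] [Module ℂ V] [AddCommGroup U] [Module ℂ U]
  [AddCommGroup W] [Module ℂ W] {ρ : Representation ℂ (K n) V} {τ : Representation ℂ (K n) U}

theorem IsSmooth.of_surjective (h : IsSmooth ρ) (F : V →ₗ[ℂ] U) (hF : Function.Surjective F)
    (hFk : ∀ k v, F (ρ k v) = τ k (F v)) : IsSmooth τ := by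
  intro φ u
  obtain ⟨v, rfl⟩ := hF u
  have h1 := h (φ ∘ₗ F) v
  simpa only [LinearMap.comp_apply, hFk] using h1

theorem IsSmooth.of_ne_zero (h : IsSmooth ρ) (hτ : τ.IsIrreducible) (F : V →ₗ[ℂ] U)
    (hF : F ≠ 0) (hFk : ∀ k v, F (ρ k v) = τ k (F v)) : IsSmooth τ := by
  refine h.of_surjective F (LinearMap.range_eq_top.1 ?_) hFk
  obtain ⟨v, hv⟩ : ∃ v, F v ≠ 0 := by
    by_contra! h
    exact hF (LinearMap.ext h)
  refine eq_top_of_stable hτ ?_ hv ⟨v, rfl⟩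
  rintro k _ ⟨w, rfl⟩
  exact ⟨ρ k w, hFk k w⟩

theorem IsSmooth.dual [FiniteDimensional ℂ V] (h : IsSmooth ρ) : IsSmooth ρ.dual := by
  intro F f
  obtain ⟨v, rfl⟩ := (Module.evalEquiv ℂ V).surjective F
  exact inv_mem_smoothAtOne (h f v)

theorem IsSmooth.extPower [FiniteDimensional ℂ V] (h : IsSmooth ρ) (m : ℕ) :
    IsSmooth (extPower ρ m) := by
  intro φ x
  have hx : x ∈ Submodule.span ℂ (Set.range (exteriorPower.ιMulti ℂ m (M := V))) := by
    rw [exteriorPower.ιMulti_span]; trivial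
  induction hx using Submodule.span_induction with
  | zero =>
    simp only [map_zero]
    exact (smoothAtOne n).zero_mem
  | add x y _ _ hx hy =>
    simp only [map_add]
    exact (smoothAtOne n).add_mem hx hy
  | smul a x _ hx =>
    simp only [map_smul]
    exact (smoothAtOne n).smul_mem hx a
  | mem x hx =>
    obtain ⟨v, rfl⟩ := hx
    let b := Module.finBasis ℂ V
    have e : (fun k => φ (RankinSelberg.extPower ρ m k (exteriorPower.ιMulti ℂ m v))) =
        ∑ r : Fin m → Fin (Module.finrank ℂ V),
          (∏ i, fun k => b.coord (r i) (ρ k (v i))) *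
            (fun _ => φ (exteriorPower.ιMulti ℂ m fun i => b (r i))) := by
      funext k
      change φ (exteriorPower.map m (ρ k) (exteriorPower.ιMulti ℂ m v)) = _
      rw [exteriorPower.map_apply_ιMulti]
      have e1 : (ρ k : V → V) ∘ v = fun i => ∑ j, b.coord j (ρ k (v i)) • b j := by
        funext i
        simp [b.sum_repr]
      rw [e1, ← AlternatingMap.coe_multilinearMap, MultilinearMap.map_sum, map_sum,
        Finset.sum_apply]
      refine Finset.sum_congr rfl fun r _ => ?_
      rw [MultilinearMap.map_smul_univ, map_smul, smul_eq_mul, Pi.mul_apply, Finset.prod_apply]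
    rw [e]
    exact Subalgebra.sum_mem _ fun r _ => Subalgebra.mul_mem _
      (Subalgebra.prod_mem _ fun i _ => h _ _) (Subalgebra.algebraMap_mem (smoothAtOne n) _)

end SmoothConstructions

/-! ### 𝔤/𝔨̃ as 𝔤𝔩ₙ modulo scalars -/

section Quotient

variable (n : ℕ)

/-- The map `𝔤𝔩ₙ(ℂ) → 𝔤/𝔨̃`, `X ↦ (X, 0)`. -/
def glToQuot : Matrix (Fin n) (Fin n) ℂ →ₗ[ℂ] GModK n :=
  (kTilde n).mkQ ∘ₗ LinearMap.inl ℂ _ _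

variable {n}

/-- These pairs form the complexification of 𝔲(n): for skew-Hermitian X one has X̄ = -Xᵀ. -/
theorem neg_transpose_mem_kTilde (Y : Matrix (Fin n) (Fin n) ℂ) : (Y, -Yᵀ) ∈ kTilde n := by
  let F : Matrix (Fin n) (Fin n) ℂ →ₗ[ℂ] LieG n :=
    LinearMap.prod LinearMap.id (-(Matrix.transposeLinearEquiv (Fin n) (Fin n) ℂ ℂ).toLinearMap)
  have key : (kTilde n).mkQ ∘ₗ F = 0 := by
    refine linearMap_ext_skewAdjoint fun X => ?_
    rw [LinearMap.comp_apply, LinearMap.zero_apply, Submodule.mkQ_apply,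
      Submodule.Quotient.mk_eq_zero]
    have hX : X.1ᴴ = -X.1 := X.2
    refine Submodule.subset_span ⟨X.1, ⟨0, by simp [hX]⟩, ?_⟩
    refine Prod.ext rfl ?_
    change X.1.map star = -X.1ᵀ
    rw [← Matrix.transpose_neg, ← hX]
    rfl
  have h1 := LinearMap.congr_fun key Y
  rwa [LinearMap.comp_apply, LinearMap.zero_apply, Submodule.mkQ_apply,
    Submodule.Quotient.mk_eq_zero] at h1

theorem glToQuot_surjective : Function.Surjective (glToQuot n) := by
  intro x
  obtain ⟨⟨A, B⟩, rfl⟩ := Submodule.Quotient.mk_surjective _ x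
  refine ⟨A + Bᵀ, ?_⟩
  change (Submodule.Quotient.mk (A + Bᵀ, 0) : GModK n) = _
  rw [Submodule.Quotient.eq]
  convert neg_transpose_mem_kTilde Bᵀ using 1
  ext <;> simp

/-- The map (A, B) ↦ A + Bᵀ sends 𝔨̃ to scalars, as X + X̄ᵗ is scalar on its generators. Conversely
(1, -1) and (1, 1) lie in 𝔨̃ and add up to (2, 0). -/
theorem glToQuot_eq_zero_iff (X : Matrix (Fin n) (Fin n) ℂ) :
    glToQuot n X = 0 ↔ ∃ c : ℂ, X = c • (1 : Matrix (Fin n) (Fin n) ℂ) := by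
  change (Submodule.Quotient.mk (X, 0) : GModK n) = 0 ↔ _
  rw [Submodule.Quotient.mk_eq_zero]
  constructor
  · intro h
    let S : Submodule ℂ (LieG n) := (Submodule.span ℂ {(1 : Matrix (Fin n) (Fin n) ℂ)}).comap
      (LinearMap.fst ℂ _ _ +
        (Matrix.transposeLinearEquiv (Fin n) (Fin n) ℂ ℂ).toLinearMap ∘ₗ LinearMap.snd ℂ _ _)
    have hS : kTilde n ≤ S := by
      refine Submodule.span_le.2 ?_
      rintro _ ⟨Y, ⟨c, hc⟩, rfl⟩
      refine Submodule.mem_span_singleton.2 ⟨c, ?_⟩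
      rw [← hc]
      rfl
    obtain ⟨c, hc⟩ := Submodule.mem_span_singleton.1 (hS h)
    exact ⟨c, by simpa using hc.symm⟩
  · rintro ⟨c, rfl⟩
    have h1 : ((1 : Matrix (Fin n) (Fin n) ℂ), -(1 : Matrix (Fin n) (Fin n) ℂ)ᵀ) ∈ kTilde n :=
      neg_transpose_mem_kTilde 1
    have h2 : ((1 : Matrix (Fin n) (Fin n) ℂ), (1 : Matrix (Fin n) (Fin n) ℂ)) ∈ kTilde n := by
      refine Submodule.subset_span ⟨1, ⟨2, ?_⟩, ?_⟩
      · rw [Matrix.conjTranspose_one]; module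
      · exact Prod.ext rfl (by simp [complexify])
    have h3 := (kTilde n).smul_mem (c / 2) ((kTilde n).add_mem h1 h2)
    convert h3 using 1
    refine Prod.ext ?_ ?_
    · simp only [Prod.smul_fst, Prod.fst_add]; module
    · simp

theorem adGModK_glToQuot (k : K n) (X : Matrix (Fin n) (Fin n) ℂ) :
    adGModK n k (glToQuot n X) = glToQuot n (k.1 * X * k.1ᴴ) := by
  change (Submodule.Quotient.mk (adG n k (X, 0)) : GModK n) = Submodule.Quotient.mk _
  congr 1
  refine Prod.ext rfl ?_
  change k.1.map star * 0 * (k.1.map star)ᴴ = 0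
  simp

theorem isSmooth_adGModK : IsSmooth (adGModK n) := by
  intro φ x
  obtain ⟨X, rfl⟩ := glToQuot_surjective x
  have e : (fun k => φ (adGModK n k (glToQuot n X))) = ∑ i, ∑ j,
      (∑ b, (∑ a, (fun k : K n => k.1 i a) * fun _ => X a b) * fun k : K n => star (k.1 j b)) *
        fun _ => φ (glToQuot n (Matrix.single i j 1)) := by
    funext k
    rw [adGModK_glToQuot, Matrix.matrix_eq_sum_single (k.1 * X * k.1ᴴ)]
    simp only [map_sum, Finset.sum_apply, Pi.mul_apply]
    refine Finset.sum_congr rfl fun i _ => Finset.sum_congr rfl fun j _ => ?_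
    have e1 : Matrix.single i j ((k.1 * X * k.1ᴴ) i j) =
        (k.1 * X * k.1ᴴ) i j • Matrix.single i j (1 : ℂ) := by simp [Matrix.smul_single]
    rw [e1, map_smul, map_smul, smul_eq_mul]
    simp [Matrix.mul_apply]
  rw [e]
  have hc : ∀ c : ℂ, (fun _ => c) ∈ smoothAtOne n := (smoothAtOne n).algebraMap_mem
  exact Subalgebra.sum_mem _ fun i _ => Subalgebra.sum_mem _ fun j _ => Subalgebra.mul_mem _
    (Subalgebra.sum_mem _ fun b _ => Subalgebra.mul_mem _ (Subalgebra.sum_mem _ fun a _ =>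
      Subalgebra.mul_mem _ (apply_mem_smoothAtOne i a) (hc _)) (star_apply_mem_smoothAtOne j b))
    (hc _)

theorem isSmooth_adGModKCube (i : K n →* K n × K n × K n)
    (hi : (∀ k, i k = (k, 1, 1)) ∨ (∀ k, i k = (1, k, 1)) ∨ ∀ k, i k = (1, 1, k)) :
    IsSmooth ((adGModKCube n).comp i) := by
  rintro φ ⟨x, y, z⟩
  have hc : ∀ c : ℂ, (fun _ => c) ∈ smoothAtOne n := (smoothAtOne n).algebraMap_mem
  have e0 : ∀ x y z, φ (x, y, z) = (φ ∘ₗ LinearMap.inl ℂ _ _) x +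
      (φ ∘ₗ LinearMap.inr ℂ _ _ ∘ₗ LinearMap.inl ℂ _ _) y +
      (φ ∘ₗ LinearMap.inr ℂ _ _ ∘ₗ LinearMap.inr ℂ _ _) z := fun x y z => by
    simp [← map_add]
  rcases hi with hi | hi | hi
  · have e : (fun k => φ ((adGModKCube n).comp i k (x, y, z))) =
      fun k => φ (adGModK n k x, adGModK n 1 y, adGModK n 1 z) := by
      funext k; rw [MonoidHom.comp_apply, hi]; rfl
    rw [e]
    simp only [e0]
    exact Subalgebra.add_mem _ (Subalgebra.add_mem _ (isSmooth_adGModK _ _) (hc _)) (hc _)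
  · have e : (fun k => φ ((adGModKCube n).comp i k (x, y, z))) =
      fun k => φ (adGModK n 1 x, adGModK n k y, adGModK n 1 z) := by
      funext k; rw [MonoidHom.comp_apply, hi]; rfl
    rw [e]
    simp only [e0]
    exact Subalgebra.add_mem _ (Subalgebra.add_mem _ (hc _) (isSmooth_adGModK _ _)) (hc _)
  · have e : (fun k => φ ((adGModKCube n).comp i k (x, y, z))) =
      fun k => φ (adGModK n 1 x, adGModK n 1 y, adGModK n k z) := by
      funext k; rw [MonoidHom.comp_apply, hi]; rfl
    rw [e]
    simp only [e0]
    exact Subalgebra.add_mem _ (Subalgebra.add_mem _ (hc _) (hc _)) (isSmooth_adGModK _ _)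

end Quotient

/-! ### Roots, coweights and sums of positive roots -/

section Roots

variable {n : ℕ}

/-- The root `ε_i - ε_j` attached to the pair `(i, j)`. -/
def pairRoot (p : Fin n × Fin n) : Fin n → ℤ := Pi.single p.1 1 - Pi.single p.2 1

/-- The pairs `(i, j)` on whose roots the coweight `h` is positive. -/
def posPairs (h : Fin n → ℤ) : Finset (Fin n × Fin n) :=
  Finset.univ.filter fun p => h p.2 < h p.1

/-- The sum of the roots on which the coweight `h` is positive. -/
def sumPos (h : Fin n → ℤ) : Fin n → ℤ := ∑ p ∈ posPairs h, pairRoot p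

theorem mem_posPairs {h : Fin n → ℤ} {p : Fin n × Fin n} : p ∈ posPairs h ↔ h p.2 < h p.1 := by
  simp [posPairs]

theorem sumPos_apply (h : Fin n → ℤ) (i : Fin n) :
    sumPos h i = (Finset.univ.filter fun j => h j < h i).card -
      (Finset.univ.filter fun j => h i < h j).card := by
  have e1 : ∑ p ∈ posPairs h, (Pi.single p.1 1 : Fin n → ℤ) i =
      (Finset.univ.filter fun j => h j < h i).card := by
    rw [posPairs, Finset.sum_filter, Fintype.sum_prod_type, Finset.sum_eq_single i]
    · simp
    · intro b _ hb
      simp [hb.symm]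
    · simp
  have e2 : ∑ p ∈ posPairs h, (Pi.single p.2 1 : Fin n → ℤ) i =
      (Finset.univ.filter fun j => h i < h j).card := by
    rw [posPairs, Finset.sum_filter, Fintype.sum_prod_type_right, Finset.sum_eq_single i]
    · simp
    · intro b _ hb
      simp [hb.symm]
    · simp
  rw [sumPos, Finset.sum_apply, ← e1, ← e2, ← Finset.sum_sub_distrib]
  rfl

theorem sumPos_comp (h : Fin n → ℤ) (π : Equiv.Perm (Fin n)) :
    sumPos h ∘ π = sumPos (h ∘ π) := by
  funext i
  rw [Function.comp_apply, sumPos_apply, sumPos_apply]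
  have key : ∀ P : Fin n → Prop, ∀ [DecidablePred P] [DecidablePred fun j => P (π j)],
      (Finset.univ.filter P).card = (Finset.univ.filter fun j => P (π j)).card := by
    intro P _ _
    rw [← Fintype.card_subtype, ← Fintype.card_subtype]
    exact (Fintype.card_congr (π.subtypeEquiv fun _ => Iff.rfl)).symm
  rw [key fun j => h j < h (π i), key fun j => h (π i) < h j]
  rfl

theorem pairRoot_comp_swap (i j : Fin n) :
    pairRoot (i, j) ∘ Equiv.swap i j = pairRoot (j, i) := by
  funext k
  simp only [pairRoot, Function.comp_apply, Pi.sub_apply, Pi.single_apply]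
  congr 1
  · simp [Equiv.swap_apply_eq_iff]
  · simp [Equiv.swap_apply_eq_iff]

/-- The functional μ ↦ ∑ k μ_k is nonpositive on the cone but positive on a negative root. -/
theorem pairRoot_not_mem_posRootCone {i j : Fin n} (hij : j < i) :
    pairRoot (i, j) ∉ posRootCone n := by
  intro hmem
  have key : ∀ μ ∈ posRootCone n, ∑ k : Fin n, (k : ℤ) * μ k ≤ 0 := by
    intro μ hμ
    induction hμ using AddSubmonoid.closure_induction with
    | zero => simp
    | add x y _ _ hx hy =>
      simp only [Pi.add_apply, mul_add, Finset.sum_add_distrib]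
      omega
    | mem x hx =>
      obtain ⟨a, b, hab, rfl⟩ := hx
      simp only [Pi.sub_apply, mul_sub, Finset.sum_sub_distrib, Pi.single_apply, mul_ite, mul_one,
        mul_zero, Finset.sum_ite_eq', Finset.mem_univ, if_true]
      have : (a : ℕ) < b := hab
      omega
  have h1 := key _ hmem
  simp only [pairRoot, Pi.sub_apply, mul_sub, Finset.sum_sub_distrib, Pi.single_apply, mul_ite,
    mul_one, mul_zero, Finset.sum_ite_eq', Finset.mem_univ, if_true] at h1
  have : (j : ℕ) < i := hij
  omega

end Roots

/-! ### Lowest weight vectors -/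

section Lowest

variable {n : ℕ} {V : Type*} [AddCommGroup V] [Module ℂ V]

/-- `v` is a lowest weight vector, of weight `-sumPos h`, of the irreducible representation `ρ`. -/
structure IsLowest (h : Fin n → ℤ) (ρ : Representation ℂ (K n) V) (v : V) : Prop where
  irreducible : ρ.IsIrreducible
  ne_zero : v ≠ 0
  hasWeight : HasWeight ρ (-sumPos h) v
  lowest : ∀ μ : Fin n → ℤ, IsWeight ρ μ → sumPos h + μ ∈ posRootCone n

variable {h : Fin n → ℤ} {ρ : Representation ℂ (K n) V} {v : V}
  {d : Matrix (Fin n) (Fin n) ℂ →ₗ[ℂ] Module.End ℂ V}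

/-- For i > j the new weight would lie below the lowest one. For i < j the hypotheses force h i = h
j, so the transposition of i and j fixes `sumPos h`; it reflects the new weight to one excluded by
the first case. -/
theorem IsLowest.single_eq_zero (hv : IsLowest h ρ v) (hh : Antitone h) (hd : IsDifferential ρ d)
    {i j : Fin n} (hij : i ≠ j) (hle : h i ≤ h j) : d (Matrix.single i j 1) v = 0 := by
  by_contra h0
  have hw := hv.hasWeight.single hd i j
  rcases lt_or_gt_of_ne hij with hlt | hgt
  · have heq : h i = h j := le_antisymm hle (hh hlt.le)
    have hw2 := hw.permK (Equiv.swap i j)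
    have e0 : sumPos h ∘ Equiv.swap i j = sumPos h := by
      rw [sumPos_comp]
      congr 1
      funext k
      rw [Function.comp_apply, Equiv.swap_apply_def]
      split_ifs with h1 h2
      · rw [h1, heq]
      · rw [h2, heq]
      · rfl
    have e : (-sumPos h + (Pi.single i 1 - Pi.single j 1)) ∘ Equiv.swap i j =
        -sumPos h + pairRoot (j, i) := by
      rw [← pairRoot_comp_swap i j]
      conv_rhs => rw [← e0]
      rfl
    rw [e] at hw2
    have h1 := hv.lowest _ ⟨_, fun h => h0 ((ρ.apply_bijective _).1 (h.trans (map_zero _).symm)),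
      hw2⟩
    rw [add_neg_cancel_left] at h1
    exact pairRoot_not_mem_posRootCone hlt h1
  · have h1 := hv.lowest _ ⟨_, h0, hw⟩
    rw [add_neg_cancel_left] at h1
    exact pairRoot_not_mem_posRootCone hgt h1

theorem IsLowest.eq_top [FiniteDimensional ℂ V] (hv : IsLowest h ρ v) (hh : Antitone h)
    (hd : IsDifferential ρ d) {Q : Submodule ℂ V} (hvQ : v ∈ Q)
    (hQ : ∀ p ∈ posPairs h, ∀ w ∈ Q, d (Matrix.single p.1 p.2 1) w ∈ Q) : Q = ⊤ := by
  refine eq_top_of_generated hv.irreducible hd (fun i j => h j < h i) hv.ne_zero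
    (fun i j => ?_) hvQ (fun i j hij => hQ (i, j) (mem_posPairs.2 hij))
  by_cases hlt : h j < h i
  · exact Or.inl hlt
  · right
    by_cases hij : i = j
    · subst hij
      exact ⟨_, hv.hasWeight.single_self hd i⟩
    · exact ⟨0, by rw [hv.single_eq_zero hh hd hij (not_lt.1 hlt), zero_smul]⟩

theorem IsKType.exists_isLowest_dual (hρ : IsKType (sumPos h) ρ) :
    ∃ f, IsLowest h ρ.dual f := by
  have := hρ.finiteDimensional
  obtain ⟨v, hv, hw⟩ := hρ.isWeight
  obtain ⟨f, hf, hfw⟩ := exists_dual_hasWeight hρ.continuous hv hw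
  refine ⟨f, IsIrreducible.dual hρ.irreducible, fun h0 => hf (by simp [h0]), fun t => ?_,
    fun μ hμ => ?_⟩
  · refine LinearMap.ext fun w => ?_
    rw [dual_apply_apply, ← diagTorus_inv, ← weightChar_inv]
    exact hfw t⁻¹ w
  · simpa using hρ.highest _ (hμ.of_dual hρ.continuous)

end Lowest

/-! ### Invariant trilinear forms and abelian nilradicals -/

section Invariants

variable {n : ℕ} {V U W : Type*} [AddCommGroup V] [Module ℂ V] [AddCommGroup U] [Module ℂ U]
  [AddCommGroup W] [Module ℂ W]

/-- The nilradical attached to `h` is abelian and its roots are linearly independent, as witnessed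
by coordinates. -/
structure IsAbelianHeight (h : Fin n → ℤ) : Prop where
  snd_ne_fst : ∀ p ∈ posPairs h, ∀ q ∈ posPairs h, p.2 ≠ q.1
  exists_coord : ∀ p ∈ posPairs h, ∃ (k : Fin n) (s : ℤ), ∀ q ∈ posPairs h,
    s * pairRoot q k = if q = p then 1 else 0

/-- The coordinate dual to the root of p reads off the multiplicity of p from the sum, so each
positive pair occurs exactly once. -/
theorem IsAbelianHeight.perm {h : Fin n → ℤ} (hh : IsAbelianHeight h)
    {l : List (Fin n × Fin n)} (hl : ∀ p ∈ l, p ∈ posPairs h)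
    (hsum : (l.map pairRoot).sum = sumPos h) : l.Perm (posPairs h).toList := by
  classical
  rw [List.perm_iff_count]
  intro p
  by_cases hp : p ∈ posPairs h
  · rw [List.count_eq_one_of_mem (Finset.nodup_toList _) (Finset.mem_toList.2 hp)]
    obtain ⟨k, s, hks⟩ := hh.exists_coord p hp
    have key : ∀ l : List (Fin n × Fin n), (∀ q ∈ l, q ∈ posPairs h) →
        s * (l.map pairRoot).sum k = l.count p := by
      intro l hl
      induction l with
      | nil => simp
      | cons a l ih =>
        rw [List.map_cons, List.sum_cons, Pi.add_apply, mul_add,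
          ih fun q hq => hl q (List.mem_cons_of_mem _ hq), hks a (hl a List.mem_cons_self),
          List.count_cons]
        by_cases ha : a = p <;> simp [ha, add_comm]
    have h1 := key l hl
    rw [hsum, sumPos, Finset.sum_apply, Finset.mul_sum, Finset.sum_congr rfl hks,
      Finset.sum_ite_eq' (posPairs h) p, if_pos hp] at h1
    exact_mod_cast h1.symm
  · rw [List.count_eq_zero_of_not_mem fun h => hp (hl p h),
      List.count_eq_zero_of_not_mem fun h => hp (Finset.mem_toList.1 h)]

/-- The result of applying successively the operators `d(E_ij)`, `(i, j) ∈ l`, to `w`. -/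
def applyWord (d : Matrix (Fin n) (Fin n) ℂ →ₗ[ℂ] Module.End ℂ W) (w : W)
    (l : List (Fin n × Fin n)) : W :=
  l.foldr (fun p x => d (Matrix.single p.1 p.2 1) x) w

variable {ρ : Representation ℂ (K n) V} {τ : Representation ℂ (K n) U}
  {σ : Representation ℂ (K n) W}
  {dV : Matrix (Fin n) (Fin n) ℂ →ₗ[ℂ] Module.End ℂ V}
  {dU : Matrix (Fin n) (Fin n) ℂ →ₗ[ℂ] Module.End ℂ U}
  {dW : Matrix (Fin n) (Fin n) ℂ →ₗ[ℂ] Module.End ℂ W}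

theorem HasWeight.applyWord (hd : IsDifferential σ dW) {μ : Fin n → ℤ} {w : W}
    (hw : HasWeight σ μ w) (l : List (Fin n × Fin n)) :
    HasWeight σ (μ + (l.map pairRoot).sum) (applyWord dW w l) := by
  induction l with
  | nil => simpa [RankinSelberg.applyWord] using hw
  | cons a l ih =>
    rw [List.map_cons, List.sum_cons, add_comm (pairRoot a), ← add_assoc]
    exact ih.single hd a.1 a.2

theorem applyWord_perm [FiniteDimensional ℂ W] (hd : IsDifferential σ dW) {h : Fin n → ℤ}
    (hh : IsAbelianHeight h) (w : W) {l l' : List (Fin n × Fin n)} (hl : ∀ p ∈ l, p ∈ posPairs h)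
    (hp : l.Perm l') : applyWord dW w l = applyWord dW w l' := by
  refine hp.foldr_eq' (fun x hx y hy z => ?_) w
  rw [hd.bracket, Matrix.single_mul_single_of_ne _ _ _ _ (hh.snd_ne_fst _ (hl _ ?_) _ (hl _ ?_)),
    Matrix.single_mul_single_of_ne _ _ _ _ (hh.snd_ne_fst _ (hl _ ?_) _ (hl _ ?_))]
  · simp
  all_goals assumption

/-- Words in the positive operators applied to w span W, and an invariant functional sees only those
of weight zero. Such a word uses each positive root once; the operators commute, so it equals the
word in `h0`. -/
theorem IsLowest.functional_eq_zero [FiniteDimensional ℂ W] {h : Fin n → ℤ} (hh : Antitone h)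
    (hab : IsAbelianHeight h) (hd : IsDifferential σ dW) {w : W} (hw : IsLowest h σ w)
    {ℓ : Module.Dual ℂ W} (hℓ : ∀ t x, ℓ (σ (diagTorus t) x) = ℓ x)
    (h0 : ℓ (applyWord dW w (posPairs h).toList) = 0) : ℓ = 0 := by
  have key : ∀ l : List (Fin n × Fin n), (∀ p ∈ l, p ∈ posPairs h) →
      ℓ (applyWord dW w l) = 0 := by
    intro l hl
    by_contra hne
    have h1 := hw.hasWeight.applyWord hd l
    have h2 : -sumPos h + (l.map pairRoot).sum = 0 := by
      refine weightChar_injective fun t => ?_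
      have h3 := hℓ t (applyWord dW w l)
      rw [h1 t, map_smul, smul_eq_mul] at h3
      rw [weightChar_zero]
      exact mul_right_cancel₀ hne (h3.trans (one_mul _).symm)
    rw [applyWord_perm hd hab w hl (hab.perm hl (neg_add_eq_zero.1 h2).symm)] at hne
    exact hne h0
  let S : Submodule ℂ W :=
    Submodule.span ℂ (applyWord dW w '' {l | ∀ p ∈ l, p ∈ posPairs h})
  have hS : S = ⊤ := by
    refine hw.eq_top hh hd (Submodule.subset_span ⟨[], by simp, rfl⟩) fun p hp x hx => ?_
    induction hx using Submodule.span_induction with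
    | zero => rw [map_zero]; exact S.zero_mem
    | add x y _ _ hx hy => rw [map_add]; exact S.add_mem hx hy
    | smul a x _ hx => rw [map_smul]; exact S.smul_mem a hx
    | mem x hx =>
      obtain ⟨l, hl, rfl⟩ := hx
      refine Submodule.subset_span ⟨p :: l, ?_, rfl⟩
      intro q hq
      rcases List.mem_cons.1 hq with rfl | hq
      exacts [hp, hl q hq]
  refine LinearMap.ext fun x => ?_
  have hx : x ∈ S := hS ▸ Submodule.mem_top
  have hle : S ≤ LinearMap.ker ℓ := by
    refine Submodule.span_le.2 ?_
    rintro _ ⟨l, hl, rfl⟩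
    exact key l hl
  exact hle hx

theorem trilinear_differential [FiniteDimensional ℂ V] [FiniteDimensional ℂ W]
    (hV : IsDifferential ρ dV) (hU : IsDifferential τ dU)
    (hW : IsDifferential σ dW) {L : V →ₗ[ℂ] U →ₗ[ℂ] W →ₗ[ℂ] ℂ}
    (hL : ∀ k x y z, L (ρ k x) (τ k y) (σ k z) = L x y z) (X : Matrix (Fin n) (Fin n) ℂ)
    (x : V) (y : U) (z : W) : L (dV X x) y z + L x (dU X y) z + L x y (dW X z) = 0 := by
  have key : ((L.flip y).flip z) ∘ₗ dV.flip x + ((L x).flip z) ∘ₗ dU.flip y +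
      L x y ∘ₗ dW.flip z = 0 := by
    refine linearMap_ext_skewAdjoint fun X => ?_
    have h1 := ((hV X x).bilin L (hU X y)).bilin
      (LinearMap.id : Module.Dual ℂ W →ₗ[ℂ] Module.Dual ℂ W) (hW X z)
    simp only [LinearMap.id_coe, id_eq, hL, expCurve_zero, map_one, Module.End.one_apply] at h1
    exact h1.unique (hasWeakDerivAt_const _ _)
  exact LinearMap.congr_fun key X

/-- The weights of v and u cancel, so L(v, u, ·) is torus-invariant and vanishes by `h0`. By the
Leibniz rule and E_p u = 0, the x with L(x, u, ·) = 0 are stable under raising operators, hence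
everything. Finally u generates U under K. -/
theorem trilinear_eq_zero [FiniteDimensional ℂ V] [FiniteDimensional ℂ U] [FiniteDimensional ℂ W]
    (hV : IsDifferential ρ dV) (hU : IsDifferential τ dU) (hW : IsDifferential σ dW)
    {h h' : Fin n → ℤ} (hh : Antitone h) (hh' : Antitone h') (hab : IsAbelianHeight h')
    (hτ : τ.IsIrreducible) {v : V} {u : U} {w : W} (hv : IsLowest h ρ v) (hu : u ≠ 0)
    (huw : HasWeight τ (sumPos h) u)
    (hu0 : ∀ p ∈ posPairs h, dU (Matrix.single p.1 p.2 1) u = 0) (hw : IsLowest h' σ w)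
    {L : V →ₗ[ℂ] U →ₗ[ℂ] W →ₗ[ℂ] ℂ}
    (hL : ∀ k x y z, L (ρ k x) (τ k y) (σ k z) = L x y z)
    (h0 : L v u (applyWord dW w (posPairs h').toList) = 0) : L = 0 := by
  have h1 : L v u = 0 := by
    refine hw.functional_eq_zero hh' hab hW (fun t z => ?_) h0
    rw [← hL (diagTorus t) v u z, hv.hasWeight t, huw t, map_smul, map_smul, LinearMap.smul_apply,
      LinearMap.smul_apply, LinearMap.smul_apply, smul_smul, mul_comm, weightChar_neg_mul,
      one_smul]
  have h2 : LinearMap.ker (L.flip u) = ⊤ := by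
    refine hv.eq_top hh hV h1 fun p hp x hx => ?_
    rw [LinearMap.mem_ker] at hx ⊢
    refine LinearMap.ext fun z => ?_
    have h3 := trilinear_differential hV hU hW hL (Matrix.single p.1 p.2 1) x u z
    have h4 : ∀ z, L x u z = 0 := fun z => LinearMap.congr_fun hx z
    rw [hu0 p hp, map_zero, LinearMap.zero_apply, h4, add_zero, add_zero] at h3
    exact h3
  have h3 : LinearMap.ker L.flip = ⊤ := by
    refine eq_top_of_stable hτ (fun k y hy => ?_) hu (LinearMap.ker_eq_top.1 h2)
    rw [LinearMap.mem_ker] at hy ⊢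
    refine LinearMap.ext fun x => LinearMap.ext fun z => ?_
    have h4 := hL k⁻¹ x (τ k y) z
    rw [Representation.inv_self_apply] at h4
    change L x (τ k y) z = 0
    rw [← h4]
    exact LinearMap.congr_fun (LinearMap.congr_fun hy _) _
  refine LinearMap.ext fun x => LinearMap.ext fun y => LinearMap.ext fun z => ?_
  exact LinearMap.congr_fun (LinearMap.congr_fun (LinearMap.congr_fun
    (LinearMap.ker_eq_top.1 h3) y) x) z

end Invariants

/-! ### The coweights belonging to τ and σ -/

section Heights

variable (n : ℕ)

/-- The coweight with `sumPos (tauHeight n) = tauWeight n`. -/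
def tauHeight : Fin n → ℤ := fun i => -((i : ℕ) : ℤ)

/-- The coweight with `sumPos (sigmaHeight n) = sigmaWeight n`. -/
def sigmaHeight : Fin n → ℤ := fun i => if (i : ℕ) = 0 then 1 else 0

/-- The coweight with `sumPos (sigmaHeight' n) = sigmaWeight' n`. -/
def sigmaHeight' : Fin n → ℤ := fun i => if (i : ℕ) = n - 1 then -1 else 0

variable {n}

theorem antitone_tauHeight : Antitone (tauHeight n) := fun i j hij => by
  have : (i : ℕ) ≤ j := hij
  simp only [tauHeight]
  omega

theorem antitone_sigmaHeight : Antitone (sigmaHeight n) := fun i j hij => by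
  have : (i : ℕ) ≤ j := hij
  simp only [sigmaHeight]
  split_ifs <;> omega

theorem antitone_sigmaHeight' : Antitone (sigmaHeight' n) := fun i j hij => by
  have : (i : ℕ) ≤ j := hij
  have := j.2
  simp only [sigmaHeight']
  split_ifs <;> omega

theorem sumPos_tauHeight : sumPos (tauHeight n) = tauWeight n := by
  funext i
  have e1 : (Finset.univ.filter fun j => tauHeight n j < tauHeight n i) = Finset.Ioi i := by
    ext j
    simp [tauHeight]
  have e2 : (Finset.univ.filter fun j => tauHeight n i < tauHeight n j) = Finset.Iio i := by
    ext j
    simp [tauHeight]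
  rw [sumPos_apply, e1, e2, Fin.card_Ioi, Fin.card_Iio, tauWeight]
  omega

theorem card_filter_val_ne (a : Fin n) : (Finset.univ.filter fun j => j ≠ a).card = n - 1 := by
  rw [Finset.filter_ne', Finset.card_erase_of_mem (Finset.mem_univ _), Finset.card_univ,
    Fintype.card_fin]

theorem sumPos_sigmaHeight (hn : 2 ≤ n) : sumPos (sigmaHeight n) = sigmaWeight n := by
  funext i
  rw [sumPos_apply, sigmaWeight]
  split_ifs with hi
  · have e1 : (Finset.univ.filter fun j => sigmaHeight n j < sigmaHeight n i) =
        Finset.univ.filter fun j => j ≠ i := by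
      ext j
      simp only [sigmaHeight, hi, Finset.mem_filter_univ, ne_eq, Fin.ext_iff]
      split_ifs <;> simp_all
    have e2 : (Finset.univ.filter fun j => sigmaHeight n i < sigmaHeight n j) = ∅ := by
      ext j
      simp only [sigmaHeight, hi, Finset.mem_filter_univ]
      split_ifs <;> simp_all
    rw [e1, e2, card_filter_val_ne, Finset.card_empty]
    omega
  · have e1 : (Finset.univ.filter fun j => sigmaHeight n j < sigmaHeight n i) = ∅ := by
      ext j
      simp only [sigmaHeight, hi, Finset.mem_filter_univ]
      split_ifs <;> simp_all
    have e2 : (Finset.univ.filter fun j => sigmaHeight n i < sigmaHeight n j) =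
        {⟨0, by omega⟩} := by
      ext j
      simp only [sigmaHeight, hi, Finset.mem_filter_univ, Finset.mem_singleton, Fin.ext_iff]
      split_ifs <;> simp_all
    rw [e1, e2, Finset.card_empty, Finset.card_singleton]
    rfl

theorem sumPos_sigmaHeight' (hn : 2 ≤ n) : sumPos (sigmaHeight' n) = sigmaWeight' n := by
  funext i
  rw [sumPos_apply, sigmaWeight']
  split_ifs with hi
  · have e1 : (Finset.univ.filter fun j => sigmaHeight' n j < sigmaHeight' n i) = ∅ := by
      ext j
      simp only [sigmaHeight', hi, Finset.mem_filter_univ]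
      split_ifs <;> simp_all
    have e2 : (Finset.univ.filter fun j => sigmaHeight' n i < sigmaHeight' n j) =
        Finset.univ.filter fun j => j ≠ i := by
      ext j
      simp only [sigmaHeight', hi, Finset.mem_filter_univ, ne_eq, Fin.ext_iff]
      split_ifs <;> simp_all
    rw [e1, e2, card_filter_val_ne, Finset.card_empty]
    omega
  · have e1 : (Finset.univ.filter fun j => sigmaHeight' n j < sigmaHeight' n i) =
        {⟨n - 1, by omega⟩} := by
      ext j
      simp only [sigmaHeight', hi, Finset.mem_filter_univ, Finset.mem_singleton, Fin.ext_iff]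
      split_ifs <;> simp_all
    have e2 : (Finset.univ.filter fun j => sigmaHeight' n i < sigmaHeight' n j) = ∅ := by
      ext j
      simp only [sigmaHeight', hi, Finset.mem_filter_univ]
      split_ifs <;> simp_all
    rw [e1, e2, Finset.card_empty, Finset.card_singleton]
    rfl

theorem mem_posPairs_sigmaHeight {p : Fin n × Fin n} :
    p ∈ posPairs (sigmaHeight n) ↔ (p.1 : ℕ) = 0 ∧ (p.2 : ℕ) ≠ 0 := by
  rw [mem_posPairs, sigmaHeight, sigmaHeight]
  split_ifs <;> simp_all

theorem mem_posPairs_sigmaHeight' {p : Fin n × Fin n} :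
    p ∈ posPairs (sigmaHeight' n) ↔ (p.1 : ℕ) ≠ n - 1 ∧ (p.2 : ℕ) = n - 1 := by
  rw [mem_posPairs, sigmaHeight', sigmaHeight']
  split_ifs <;> simp_all

theorem mem_posPairs_tauHeight {p : Fin n × Fin n} :
    p ∈ posPairs (tauHeight n) ↔ p.1 < p.2 := by
  simp [mem_posPairs, tauHeight]

theorem isAbelianHeight_sigmaHeight : IsAbelianHeight (sigmaHeight n) where
  snd_ne_fst p hp q hq h := by
    rw [mem_posPairs_sigmaHeight] at hp hq
    exact hp.2 (h ▸ hq.1)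
  -- The positive roots are ε_0 - ε_j with j ≠ 0, so minus the j-th coordinate isolates one of them.
  exists_coord p hp := ⟨p.2, -1, fun q hq => by
    rw [mem_posPairs_sigmaHeight] at hp hq
    have h1 : p.2 ≠ q.1 := fun h => hp.2 (h ▸ hq.1)
    have h2 : q = p ↔ p.2 = q.2 := by
      rw [Prod.ext_iff, Fin.ext_iff, Fin.ext_iff, Fin.ext_iff]
      omega
    by_cases h3 : p.2 = q.2
    · rw [if_pos (h2.2 h3)]; simp [pairRoot, h1, ← h3]
    · rw [if_neg (mt h2.1 h3)]; simp [pairRoot, h1, h3]⟩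

theorem isAbelianHeight_sigmaHeight' : IsAbelianHeight (sigmaHeight' n) where
  snd_ne_fst p hp q hq h := by
    rw [mem_posPairs_sigmaHeight'] at hp hq
    exact hq.1 (h ▸ hp.2)
  -- Here the positive roots are ε_i - ε_{n-1} with i ≠ n - 1, isolated by the i-th coordinate.
  exists_coord p hp := ⟨p.1, 1, fun q hq => by
    rw [mem_posPairs_sigmaHeight'] at hp hq
    have h1 : p.1 ≠ q.2 := fun h => hp.1 (h ▸ hq.2)
    have h2 : q = p ↔ p.1 = q.1 := by
      rw [Prod.ext_iff, Fin.ext_iff, Fin.ext_iff, Fin.ext_iff]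
      omega
    by_cases h3 : p.1 = q.1
    · rw [if_pos (h2.2 h3)]; simp [pairRoot, h1, ← h3]
    · rw [if_neg (mt h2.1 h3)]; simp [pairRoot, h1, h3]⟩

theorem card_posPairs_tauHeight : (posPairs (tauHeight n)).card = b n := by
  have h1 : (posPairs (tauHeight n)).card = ∑ i : Fin n, (i : ℕ) := by
    rw [Finset.card_eq_sum_card_fiberwise (f := Prod.snd) (t := Finset.univ) (by simp)]
    refine Finset.sum_congr rfl fun i _ => ?_
    rw [← Fin.card_Iio i]
    refine Finset.card_bij' (fun p _ => p.1) (fun j _ => (j, i)) ?_ ?_ ?_ ?_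
    · rintro ⟨p, q⟩ h
      simp only [Finset.mem_filter, mem_posPairs_tauHeight] at h
      simpa [← h.2] using h.1
    · intro j hj
      simpa [mem_posPairs_tauHeight] using hj
    · rintro ⟨p, q⟩ h
      simp only [Finset.mem_filter] at h
      rw [← h.2]
    · intro j _; rfl
  rw [h1, Fin.sum_univ_eq_sum_range (fun i => i), Finset.sum_range_id, b]

theorem card_posPairs_sigmaHeight (hn : 2 ≤ n) : (posPairs (sigmaHeight n)).card = c n := by
  rw [c, ← card_filter_val_ne (⟨0, by omega⟩ : Fin n)]
  refine Finset.card_bij' (fun p _ => p.2) (fun j _ => (⟨0, by omega⟩, j)) ?_ ?_ ?_ ?_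
  · rintro ⟨p, q⟩ h
    simpa [Fin.ext_iff] using (mem_posPairs_sigmaHeight.1 h).2
  · intro j hj
    simpa [mem_posPairs_sigmaHeight, Fin.ext_iff] using hj
  · rintro ⟨p, q⟩ h
    exact Prod.ext (Fin.ext (mem_posPairs_sigmaHeight.1 h).1.symm) rfl
  · intro j _; rfl

theorem card_posPairs_sigmaHeight' (hn : 2 ≤ n) : (posPairs (sigmaHeight' n)).card = c n := by
  rw [c, ← card_filter_val_ne (⟨n - 1, by omega⟩ : Fin n)]
  refine Finset.card_bij' (fun p _ => p.1) (fun j _ => (j, ⟨n - 1, by omega⟩)) ?_ ?_ ?_ ?_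
  · rintro ⟨p, q⟩ h
    simpa [Fin.ext_iff] using (mem_posPairs_sigmaHeight'.1 h).1
  · intro j hj
    simpa [mem_posPairs_sigmaHeight', Fin.ext_iff] using hj
  · rintro ⟨p, q⟩ h
    exact Prod.ext rfl (Fin.ext (mem_posPairs_sigmaHeight'.1 h).2.symm)
  · intro j _; rfl

theorem sumPos_tauHeight_comp_rev :
    sumPos (tauHeight n) ∘ Fin.revPerm = -sumPos (tauHeight n) := by
  rw [sumPos_tauHeight]
  funext i
  have := i.2
  simp only [tauWeight, Function.comp_apply, Fin.revPerm_apply, Fin.val_rev, Pi.neg_apply]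
  omega

end Heights

/-! ### Multiplicity at most one -/

section Multiplicity

variable {n : ℕ} {V W : Type*} [AddCommGroup V] [Module ℂ V] [AddCommGroup W] [Module ℂ W]
  {τ : Representation ℂ (K n) V} {σ : Representation ℂ (K n) W}

/-- The trilinear form on the dual spaces attached to a tensor. -/
def triForm (t : V ⊗[ℂ] (V ⊗[ℂ] W)) :
    Module.Dual ℂ V →ₗ[ℂ] Module.Dual ℂ V →ₗ[ℂ] Module.Dual ℂ W →ₗ[ℂ] ℂ :=
  (Module.Dual.eval ℂ W).compRight ℂ ∘ₗ contrL.flip ∘ₗ contrL.flip t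

theorem triForm_apply (t : V ⊗[ℂ] (V ⊗[ℂ] W)) (f f' : Module.Dual ℂ V) (g : Module.Dual ℂ W) :
    triForm t f f' g = tri f f' g t := rfl

theorem finrank_invariants_le_one (hτ : IsKType (sumPos (tauHeight n)) τ) {h : Fin n → ℤ}
    (hσ : IsKType (sumPos h) σ) (hh : Antitone h) (hab : IsAbelianHeight h)
    (hτs : IsSmooth τ) (hσs : IsSmooth σ) :
    Module.finrank ℂ (τ.tprod (τ.tprod σ)).invariants ≤ 1 := by
  have := hτ.finiteDimensional
  have := hσ.finiteDimensional
  obtain ⟨f, hf⟩ := hτ.exists_isLowest_dual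
  obtain ⟨g, hg⟩ := hσ.exists_isLowest_dual
  obtain ⟨dV, hdV⟩ := hτs.dual.exists_isDifferential
  obtain ⟨dW, hdW⟩ := hσs.dual.exists_isDifferential
  -- The longest permutation w₀ turns the lowest weight vector f into a highest weight vector,
  -- because it negates the weight.
  let u := τ.dual (permK Fin.revPerm) f
  have hu : u ≠ 0 := fun h => hf.ne_zero ((τ.dual.apply_bijective _).1 (h.trans (map_zero _).symm))
  have huw : HasWeight τ.dual (sumPos (tauHeight n)) u := by
    have h1 := hf.hasWeight.permK Fin.revPerm
    rwa [show (-sumPos (tauHeight n)) ∘ Fin.revPerm = sumPos (tauHeight n) from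
      (congrArg Neg.neg sumPos_tauHeight_comp_rev).trans (neg_neg _)] at h1
  have hu0 : ∀ p ∈ posPairs (tauHeight n), dV (Matrix.single p.1 p.2 1) u = 0 := by
    rintro ⟨i, j⟩ hp
    rw [mem_posPairs_tauHeight] at hp
    have h1 := hdV.equivariant (permK Fin.revPerm) (Matrix.single i.rev j.rev 1) f
    have h2 : (Matrix.single i.rev j.rev (1 : ℂ)).submatrix Fin.revPerm Fin.revPerm =
        Matrix.single i j 1 := by
      ext a b
      simp [Matrix.single_apply, Fin.rev_eq_iff, Fin.rev_rev]
    rw [permK_conj, h2, hf.single_eq_zero antitone_tauHeight hdV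
      (fun h => hp.ne (Fin.rev_injective h)), map_zero] at h1
    · exact h1.symm
    · exact antitone_tauHeight (Fin.rev_le_rev.2 hp.le)
  let ev : (τ.tprod (τ.tprod σ)).invariants →ₗ[ℂ] ℂ :=
    tri f u (applyWord dW g (posPairs h).toList) ∘ₗ Submodule.subtype _
  have hinj : Function.Injective ev := by
    rw [← LinearMap.ker_eq_bot, LinearMap.ker_eq_bot']
    rintro ⟨t, ht⟩ h0
    refine Subtype.ext (eq_zero_of_tri fun x y z => ?_)
    have hL : ∀ k x y z, triForm t (τ.dual k x) (τ.dual k y) (σ.dual k z) = triForm t x y z := by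
      intro k x y z
      rw [triForm_apply, triForm_apply, dual_apply_apply, dual_apply_apply, dual_apply_apply,
        ← tri_map]
      exact congrArg _ (ht k⁻¹)
    have h1 := trilinear_eq_zero hdV hdV hdW antitone_tauHeight hh hab
      (IsIrreducible.dual hτ.irreducible) hf hu huw hu0 hg hL h0
    rw [← triForm_apply, h1]
    rfl
  simpa using LinearMap.finrank_le_finrank_of_injective hinj

end Multiplicity

/-! ### Triviality of the top exterior power of 𝔤/𝔨̃ -/

section Determinant

variable {n : ℕ}

theorem det_mul_mul (A B : Matrix (Fin n) (Fin n) ℂ) :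
    LinearMap.det (LinearMap.mulRight ℂ B ∘ₗ LinearMap.mulLeft ℂ A) = (A.det * B.det) ^ n := by
  let e : Matrix (Fin n) (Fin n) ℂ ≃ₗ[ℂ] (Fin n × Fin n → ℂ) :=
    { toFun := Matrix.vec
      invFun := fun v => Matrix.of fun i j => v (j, i)
      map_add' := fun _ _ => rfl
      map_smul' := fun _ _ => rfl
      left_inv := fun _ => rfl
      right_inv := fun _ => rfl }
  have h : LinearMap.mulRight ℂ B ∘ₗ LinearMap.mulLeft ℂ A =
      e.symm.toLinearMap ∘ₗ Matrix.toLin' (Matrix.kroneckerMap (· * ·) Bᵀ A) ∘ₗ e.symm.symm.toLinearMap := by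
    refine LinearMap.ext fun X => e.injective ?_
    have h1 := Matrix.kronecker_mulVec_vec A X Bᵀ
    rw [Matrix.transpose_transpose] at h1
    simp only [LinearMap.comp_apply, LinearEquiv.coe_coe, LinearEquiv.symm_symm,
      LinearEquiv.apply_symm_apply, Matrix.toLin'_apply]
    exact h1.symm
  rw [h, LinearMap.det_conj, LinearMap.det_toLin', Matrix.det_kronecker, Matrix.det_transpose,
    Fintype.card_fin, ← mul_pow, mul_comm]

/-- The kernel of `𝔤𝔩ₙ(ℂ) → 𝔤/𝔨̃` consists of the scalar matrices. -/
theorem finrank_gModK (hn : n ≠ 0) : Module.finrank ℂ (GModK n) + 1 = n * n := by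
  have h1 := LinearMap.finrank_range_add_finrank_ker (glToQuot n)
  have h2 : LinearMap.ker (glToQuot n) = ℂ ∙ (1 : Matrix (Fin n) (Fin n) ℂ) := by
    ext X
    rw [LinearMap.mem_ker, glToQuot_eq_zero_iff, Submodule.mem_span_singleton]
    exact exists_congr fun c => eq_comm
  have : NeZero n := ⟨hn⟩
  rwa [LinearMap.range_eq_top.2 glToQuot_surjective, finrank_top, h2,
    finrank_span_singleton one_ne_zero, Module.finrank_matrix, Fintype.card_fin,
    Module.finrank_self, mul_one] at h1

/-- Conjugation has determinant (det k · det kᴴ)ⁿ = 1 on 𝔤𝔩ₙ and fixes the scalars pointwise, so the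
quotient carries determinant 1 as well. -/
theorem det_adGModK (hn : n ≠ 0) (k : K n) : LinearMap.det (adGModK n k) = 1 := by
  have : NeZero n := ⟨hn⟩
  let e : Matrix (Fin n) (Fin n) ℂ →ₗ[ℂ] Matrix (Fin n) (Fin n) ℂ :=
    LinearMap.mulRight ℂ k.1ᴴ ∘ₗ LinearMap.mulLeft ℂ k.1
  have he1 : LinearMap.det e = 1 := by
    rw [det_mul_mul, ← Matrix.det_mul, mul_conjTranspose_self, Matrix.det_one, one_pow]
  let S := LinearMap.ker (glToQuot n)
  have hSe : ∀ x ∈ S, e x = x := by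
    intro x hx
    obtain ⟨c, rfl⟩ := (glToQuot_eq_zero_iff x).1 hx
    simp [e, mul_conjTranspose_self]
  have hle : S ≤ S.comap e := fun x hx => by
    rw [Submodule.mem_comap, hSe x hx]; exact hx
  have h1 := LinearMap.det_eq_det_mul_det S e hle
  have h2 : e.restrict hle = LinearMap.id := LinearMap.ext fun x => Subtype.ext (hSe x x.2)
  rw [he1, h2, LinearMap.det_id, one_mul] at h1
  let q : (Matrix (Fin n) (Fin n) ℂ ⧸ S) ≃ₗ[ℂ] GModK n :=
    (glToQuot n).quotKerEquivOfSurjective glToQuot_surjective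
  have h3 : adGModK n k = q.toLinearMap ∘ₗ S.mapQ S e hle ∘ₗ q.symm.toLinearMap := by
    refine LinearMap.ext fun x => ?_
    obtain ⟨X, rfl⟩ := glToQuot_surjective x
    have h4 : q.symm (glToQuot n X) = Submodule.Quotient.mk X :=
      (LinearEquiv.symm_apply_eq q).2 rfl
    rw [adGModK_glToQuot, LinearMap.comp_apply, LinearMap.comp_apply, LinearEquiv.coe_coe,
      LinearEquiv.coe_coe, h4]
    rfl
  rw [h3, LinearMap.det_conj, ← h1]

end Determinant

section Alternating

/-- An alternating form of top degree transforms by the determinant. -/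
theorem alternatingMap_apply_comp {m : ℕ} {P U : Type*} [AddCommGroup P] [Module ℂ P]
    [AddCommGroup U] [Module ℂ U] [FiniteDimensional ℂ P] (hm : Module.finrank ℂ P = m)
    (A : P [⋀^Fin m]→ₗ[ℂ] U) (f : P →ₗ[ℂ] P) (x : Fin m → P) :
    A (f ∘ x) = LinearMap.det f • A x := by
  let e := Module.finBasisOfFinrankEq ℂ P hm
  have key : ∀ x, A x = e.det x • A e := by
    intro x
    rw [← sub_eq_zero, ← Module.forall_dual_apply_eq_zero_iff ℂ]
    intro φ
    have h1 := congrArg (fun B : P [⋀^Fin m]→ₗ[ℂ] ℂ => B x)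
      ((φ.compAlternatingMap A).eq_smul_basis_det e)
    rw [map_sub, map_smul, smul_eq_mul, mul_comm, sub_eq_zero]
    exact h1
  rw [key, key x, e.det_comp, mul_smul]

end Alternating

/-! ### Extremality of the sum of positive roots -/

section Combinatorics

variable {n : ℕ}

/-- Pair both sums with h. Pairs outside `posPairs h` contribute at most 0 and those inside
contribute strictly positively, so the value of the full positive sum is reached only if none is
omitted. -/
theorem posPairs_subset {h : Fin n → ℤ} {S : Finset (Fin n × Fin n)}
    (hS : ∑ p ∈ S, pairRoot p = sumPos h) : posPairs h ⊆ S := by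
  classical
  have hpair : ∀ T : Finset (Fin n × Fin n), ∑ k, h k * (∑ p ∈ T, pairRoot p) k =
      ∑ p ∈ T, (h p.1 - h p.2) := by
    intro T
    simp only [Finset.sum_apply, Finset.mul_sum]
    rw [Finset.sum_comm]
    refine Finset.sum_congr rfl fun p _ => ?_
    simp [pairRoot, mul_sub, Finset.sum_sub_distrib, Pi.single_apply]
  have h1 : ∑ p ∈ S, (h p.1 - h p.2) = ∑ p ∈ posPairs h, (h p.1 - h p.2) := by
    rw [← hpair, ← hpair, hS, sumPos]
  rw [← Finset.sum_inter_add_sum_sdiff S (posPairs h),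
    ← Finset.sum_inter_add_sum_sdiff (posPairs h) S, Finset.inter_comm] at h1
  have h2 : ∑ p ∈ S \ posPairs h, (h p.1 - h p.2) ≤ 0 := Finset.sum_nonpos fun p hp => by
    have := (Finset.mem_sdiff.1 hp).2
    rw [mem_posPairs] at this
    omega
  intro p hp
  by_contra hpS
  have h3 : 0 < ∑ p ∈ posPairs h \ S, (h p.1 - h p.2) :=
    Finset.sum_pos (fun q hq => by
      have := (Finset.mem_sdiff.1 hq).1
      rw [mem_posPairs] at this
      omega) ⟨p, Finset.mem_sdiff.2 ⟨hp, hpS⟩⟩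
  omega

end Combinatorics

/-! ### A unitary matrix that separates diagonal matrices -/

section ChosenUnitary

variable {n : ℕ}

/-- A unitary matrix without zero entries. -/
def fullUnitary (n : ℕ) : K n :=
  -- With P the orthogonal projection onto constant vectors, all of whose entries are 1/n, this is
  -- (1 - P) + iP. Every entry has imaginary part 1/n.
  ⟨1 + Matrix.of fun _ _ => (Complex.I - 1) / n, by
    rcases Nat.eq_zero_or_pos n with rfl | hn
    · exact Matrix.mem_unitaryGroup_iff.2 (Subsingleton.elim _ _)
    have hn' : (n : ℂ) ≠ 0 := by exact_mod_cast hn.ne'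
    rw [Matrix.mem_unitaryGroup_iff, Matrix.star_eq_conjTranspose, Matrix.conjTranspose_add,
      Matrix.conjTranspose_one, mul_add, mul_one, add_mul, one_mul, add_assoc, add_eq_left]
    ext i j
    simp only [Matrix.add_apply, Matrix.of_apply, Matrix.conjTranspose_apply, Matrix.mul_apply,
      Matrix.zero_apply, Finset.sum_const, Finset.card_univ, Fintype.card_fin, nsmul_eq_mul]
    simp only [star_div₀, star_sub, star_one, star_natCast, Complex.star_def, Complex.conj_I]
    field_simp
    ring_nf
    simp⟩

theorem fullUnitary_apply_ne_zero (i j : Fin n) : (fullUnitary n).1 i j ≠ 0 := by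
  have hn : (n : ℝ) ≠ 0 := by
    have := i.2
    exact_mod_cast (by omega : n ≠ 0)
  intro h
  have h1 := congrArg Complex.im h
  have h2 : (fullUnitary n).1 i j = (1 : Matrix (Fin n) (Fin n) ℂ) i j + (Complex.I - 1) / n := rfl
  rw [h2, Complex.add_im, Matrix.one_apply] at h1
  have h3 : ((Complex.I - 1) / (n : ℂ)).im = 1 / n := by
    rw [← Complex.ofReal_natCast, Complex.div_ofReal_im]; simp
  rw [h3] at h1
  split_ifs at h1 <;> simp [hn] at h1

/-- The images of the coweight's nilradical under `fullUnitary` meet every diagonal direction. -/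
def SeparatesDiagonal (h : Fin n → ℤ) : Prop :=
  ∀ X : Matrix (Fin n) (Fin n) ℂ, (∀ i j, i ≠ j → X i j = 0) →
    (∀ p ∈ posPairs h, ((fullUnitary n).1 * X * (fullUnitary n).1ᴴ) p.1 p.2 = 0) →
      ∃ c : ℂ, X = c • (1 : Matrix (Fin n) (Fin n) ℂ)

/-- With Y = k X kᴴ, compare row 0 of kX = Yk: since Y has a single possibly nonzero entry there,
k_{0m} X_{mm} = Y_{00} k_{0m}, and k_{0m} cancels. -/
theorem separatesDiagonal_sigmaHeight (hn : 2 ≤ n) : SeparatesDiagonal (sigmaHeight n) := by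
  intro X hX hY
  let a : Fin n := ⟨0, by omega⟩
  set Y := (fullUnitary n).1 * X * (fullUnitary n).1ᴴ with hYdef
  have hY0 : ∀ j, a ≠ j → Y a j = 0 := fun j hj =>
    hY (a, j) (mem_posPairs_sigmaHeight.2 ⟨rfl, fun h => hj (Fin.ext h.symm)⟩)
  have h1 : (fullUnitary n).1 * X = Y * (fullUnitary n).1 := by
    rw [hYdef, Matrix.mul_assoc _ _ (fullUnitary n).1, conjTranspose_mul_self, Matrix.mul_one]
  have hd : ∀ m, X m m = Y a a := by
    intro m
    have h2 := congrFun (congrFun h1 a) m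
    rw [Matrix.mul_apply, Matrix.mul_apply, Finset.sum_eq_single m, Finset.sum_eq_single a] at h2
    · exact mul_left_cancel₀ (fullUnitary_apply_ne_zero a m) (h2.trans (mul_comm _ _))
    · intro j _ hj
      rw [hY0 j hj.symm, zero_mul]
    · simp
    · intro j _ hj
      rw [hX j m hj, mul_zero]
    · simp
  refine ⟨Y a a, ?_⟩
  ext i j
  by_cases hij : i = j
  · subst hij; simp [hd]
  · simp [hX i j hij, hij]

theorem separatesDiagonal_sigmaHeight' (hn : 2 ≤ n) : SeparatesDiagonal (sigmaHeight' n) := by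
  intro X hX hY
  let a : Fin n := ⟨n - 1, by omega⟩
  set Y := (fullUnitary n).1 * X * (fullUnitary n).1ᴴ with hYdef
  have hY0 : ∀ j, j ≠ a → Y j a = 0 := fun j hj =>
    hY (j, a) (mem_posPairs_sigmaHeight'.2 ⟨fun h => hj (Fin.ext h), rfl⟩)
  have h1 : X * (fullUnitary n).1ᴴ = (fullUnitary n).1ᴴ * Y := by
    rw [hYdef, ← Matrix.mul_assoc, ← Matrix.mul_assoc, conjTranspose_mul_self, Matrix.one_mul]
  have hd : ∀ m, X m m = Y a a := by
    intro m
    have h2 := congrFun (congrFun h1 m) a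
    rw [Matrix.mul_apply, Matrix.mul_apply, Finset.sum_eq_single m, Finset.sum_eq_single a] at h2
    · refine mul_right_cancel₀ ?_ (h2.trans (mul_comm _ _))
      rw [Matrix.conjTranspose_apply]
      exact star_ne_zero.2 (fullUnitary_apply_ne_zero a m)
    · intro j _ hj
      rw [hY0 j hj, mul_zero]
    · simp
    · intro j _ hj
      rw [hX m j hj.symm, zero_mul]
    · simp
  refine ⟨Y a a, ?_⟩
  ext i j
  by_cases hij : i = j
  · subst hij; simp [hd]
  · simp [hX i j hij, hij]

end ChosenUnitary

/-! ### Alternating forms of extremal weight on three copies of 𝔤𝔩ₙ -/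

section CubeForms

variable {n : ℕ}

/-- The three copies of `𝔤𝔩ₙ(ℂ)`. -/
abbrev GlCube (n : ℕ) : Type :=
  Matrix (Fin n) (Fin n) ℂ × Matrix (Fin n) (Fin n) ℂ × Matrix (Fin n) (Fin n) ℂ

/-- Indices for the matrix units in the three copies of `𝔤𝔩ₙ(ℂ)`. -/
abbrev CubeIndex (n : ℕ) : Type := (Fin n × Fin n) ⊕ ((Fin n × Fin n) ⊕ (Fin n × Fin n))

/-- The basis of matrix units. -/
def cubeBasis (n : ℕ) : Module.Basis (CubeIndex n) ℂ (GlCube n) :=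
  (Matrix.stdBasis ℂ (Fin n) (Fin n)).prod
    ((Matrix.stdBasis ℂ (Fin n) (Fin n)).prod (Matrix.stdBasis ℂ (Fin n) (Fin n)))

/-- Conjugation by a triple of unitary matrices. -/
def cubeConj (k l m : K n) : GlCube n →ₗ[ℂ] GlCube n :=
  (LinearMap.mulRight ℂ k.1ᴴ ∘ₗ LinearMap.mulLeft ℂ k.1).prodMap
    ((LinearMap.mulRight ℂ l.1ᴴ ∘ₗ LinearMap.mulLeft ℂ l.1).prodMap
      (LinearMap.mulRight ℂ m.1ᴴ ∘ₗ LinearMap.mulLeft ℂ m.1))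

theorem cubeConj_apply (k l m : K n) (x : GlCube n) :
    cubeConj k l m x = (k.1 * x.1 * k.1ᴴ, l.1 * x.2.1 * l.1ᴴ, m.1 * x.2.2 * m.1ᴴ) := rfl

theorem diagTorus_conj_stdBasis (t : Fin n → Circle) (p : Fin n × Fin n) :
    (diagTorus t).1 * Matrix.stdBasis ℂ (Fin n) (Fin n) p * (diagTorus t).1ᴴ =
      weightChar (pairRoot p) t • Matrix.stdBasis ℂ (Fin n) (Fin n) p := by
  rw [show Matrix.stdBasis ℂ (Fin n) (Fin n) p = Matrix.single p.1 p.2 1 from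
    Matrix.stdBasis_eq_single ℂ p.1 p.2]
  change Matrix.diagonal _ * _ * (Matrix.diagonal _)ᴴ = _
  rw [pairRoot, sub_eq_add_neg, weightChar_add, ← weightChar_inv, weightChar_single,
    weightChar_single, Matrix.diagonal_conjTranspose]
  ext a b
  rw [Matrix.mul_diagonal, Matrix.diagonal_mul, Matrix.smul_apply, Matrix.single_apply]
  split_ifs with hab
  · obtain ⟨rfl, rfl⟩ := hab
    rw [Pi.inv_apply, Circle.coe_inv_eq_conj]
    simp
  · simp

theorem cubeConj_cubeBasis (s t u : Fin n → Circle) (x : CubeIndex n) :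
    cubeConj (diagTorus s) (diagTorus t) (diagTorus u) (cubeBasis n x) =
      (weightChar (Sum.elim pairRoot 0 x) s *
        weightChar (Sum.elim 0 (Sum.elim pairRoot 0) x) t *
        weightChar (Sum.elim 0 (Sum.elim 0 pairRoot) x) u) • cubeBasis n x := by
  rcases x with p | p | p <;>
    simp [cubeConj_apply, cubeBasis, weightChar_zero, diagTorus_conj_stdBasis]

/-- The matrix units in the three copies spanning the lines of positive weight. -/
def cubePos (h₁ h₂ h₃ : Fin n → ℤ) : Finset (CubeIndex n) :=
  (posPairs h₁).disjSum ((posPairs h₂).disjSum (posPairs h₃))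

variable {h₁ h₂ h₃ : Fin n → ℤ} {N : ℕ} {A : GlCube n [⋀^Fin N]→ₗ[ℂ] ℂ}

/-- If A is nonzero on a family of matrix units, they are distinct and their weights add up to that
of A in each copy. By extremality the family contains `cubePos`; having N elements, it equals it. -/
theorem mem_cubePos_of_ne_zero
    (hN : (cubePos h₁ h₂ h₃).card = N)
    (hA : ∀ s t u x, A (fun m => cubeConj (diagTorus s) (diagTorus t) (diagTorus u) (x m)) =
      weightChar (sumPos h₁) s * weightChar (sumPos h₂) t * weightChar (sumPos h₃) u * A x)
    {r : Fin N → CubeIndex n} (hr : A (fun m => cubeBasis n (r m)) ≠ 0) (m : Fin N) :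
    r m ∈ cubePos h₁ h₂ h₃ := by
  classical
  have hinj : Function.Injective r := by
    by_contra hni
    refine hr (A.map_eq_zero_of_not_injective _ fun h => hni fun a b hab => h ?_)
    simp only [hab]
  have hw : ∀ s t u, (∏ m, (weightChar (Sum.elim pairRoot 0 (r m)) s *
        weightChar (Sum.elim 0 (Sum.elim pairRoot 0) (r m)) t *
        weightChar (Sum.elim 0 (Sum.elim 0 pairRoot) (r m)) u)) =
      weightChar (sumPos h₁) s * weightChar (sumPos h₂) t * weightChar (sumPos h₃) u := by
    intro s t u
    have h1 := hA s t u fun m => cubeBasis n (r m)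
    simp only [cubeConj_cubeBasis] at h1
    rw [← AlternatingMap.coe_multilinearMap, MultilinearMap.map_smul_univ, smul_eq_mul] at h1
    exact mul_right_cancel₀ hr h1
  let R : Finset (CubeIndex n) := Finset.univ.image r
  have hsum : ∀ w : CubeIndex n → Fin n → ℤ, ∑ m, w (r m) =
      ∑ p ∈ R.toLeft, w (Sum.inl p) + (∑ p ∈ R.toRight.toLeft, w (Sum.inr (Sum.inl p)) +
        ∑ p ∈ R.toRight.toRight, w (Sum.inr (Sum.inr p))) := by
    intro w
    rw [← Finset.sum_disjSum (R.toRight.toLeft) (R.toRight.toRight) fun x => w (Sum.inr x),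
      Finset.toLeft_disjSum_toRight, ← Finset.sum_disjSum R.toLeft R.toRight w,
      Finset.toLeft_disjSum_toRight, Finset.sum_image fun a _ b _ h => hinj h]
  have e1 : posPairs h₁ ⊆ R.toLeft := by
    refine posPairs_subset (weightChar_injective fun s => ?_)
    have h1 := hw s 1 1
    have h2 := hsum (Sum.elim pairRoot 0)
    simp only [Sum.elim_inl, Sum.elim_inr, Pi.zero_apply, Finset.sum_const_zero, add_zero] at h2
    rw [← h2, weightChar_sum]
    simpa [weightChar] using h1
  have e2 : posPairs h₂ ⊆ R.toRight.toLeft := by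
    refine posPairs_subset (weightChar_injective fun s => ?_)
    have h1 := hw 1 s 1
    have h2 := hsum (Sum.elim 0 (Sum.elim pairRoot 0))
    simp only [Sum.elim_inl, Sum.elim_inr, Pi.zero_apply, Finset.sum_const_zero, add_zero,
      zero_add] at h2
    rw [← h2, weightChar_sum]
    simpa [weightChar] using h1
  have e3 : posPairs h₃ ⊆ R.toRight.toRight := by
    refine posPairs_subset (weightChar_injective fun s => ?_)
    have h1 := hw 1 1 s
    have h2 := hsum (Sum.elim 0 (Sum.elim 0 pairRoot))
    simp only [Sum.elim_inl, Sum.elim_inr, Pi.zero_apply, Finset.sum_const_zero,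
      zero_add] at h2
    rw [← h2, weightChar_sum]
    simpa [weightChar] using h1
  have hsub : cubePos h₁ h₂ h₃ ⊆ R := by
    rw [← Finset.toLeft_disjSum_toRight (u := R),
      ← Finset.toLeft_disjSum_toRight (u := R.toRight)]
    exact Finset.disjSum_mono e1 (Finset.disjSum_mono e2 e3)
  have hcard : R.card = N := by
    rw [Finset.card_image_of_injective _ hinj, Finset.card_univ, Fintype.card_fin]
  rw [Finset.eq_of_subset_of_card_le hsub (hcard.le.trans hN.ge)]
  exact Finset.mem_image_of_mem r (Finset.mem_univ m)

open Classical in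
/-- The projection onto the span of the matrix units indexed by `cubePos`. -/
def cubeProj (h₁ h₂ h₃ : Fin n → ℤ) : GlCube n →ₗ[ℂ] GlCube n :=
  (cubeBasis n).constr ℂ fun x => if x ∈ cubePos h₁ h₂ h₃ then cubeBasis n x else 0

open Classical in
theorem cubeProj_cubeBasis (x : CubeIndex n) : cubeProj h₁ h₂ h₃ (cubeBasis n x) =
    if x ∈ cubePos h₁ h₂ h₃ then cubeBasis n x else 0 :=
  Module.Basis.constr_basis _ _ _ _

theorem apply_cubeProj (hN : (cubePos h₁ h₂ h₃).card = N)
    (hA : ∀ s t u x, A (fun m => cubeConj (diagTorus s) (diagTorus t) (diagTorus u) (x m)) =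
      weightChar (sumPos h₁) s * weightChar (sumPos h₂) t * weightChar (sumPos h₃) u * A x)
    (y : Fin N → GlCube n) : A (fun m => cubeProj h₁ h₂ h₃ (y m)) = A y := by
  have key : A.compLinearMap (cubeProj h₁ h₂ h₃) = A := by
    refine Module.Basis.ext_alternating (cubeBasis n) fun r _ => ?_
    rw [AlternatingMap.compLinearMap_apply]
    by_cases hr : ∀ m, r m ∈ cubePos h₁ h₂ h₃
    · congr 1
      funext m
      rw [cubeProj_cubeBasis, if_pos (hr m)]
    · obtain ⟨m, hm⟩ := not_forall.1 hr
      have h1 : A (fun m => cubeBasis n (r m)) = 0 := by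
        by_contra h
        exact hm (mem_cubePos_of_ne_zero hN hA h m)
      rw [h1]
      exact A.map_coord_zero m (by rw [cubeProj_cubeBasis, if_neg hm])
  exact congrArg (fun B : GlCube n [⋀^Fin N]→ₗ[ℂ] ℂ => B y) key

theorem repr_cubeProj {x : CubeIndex n} (hx : x ∈ cubePos h₁ h₂ h₃) (y : GlCube n) :
    (cubeBasis n).repr (cubeProj h₁ h₂ h₃ y) x = (cubeBasis n).repr y x := by
  have key : (cubeBasis n).coord x ∘ₗ cubeProj h₁ h₂ h₃ = (cubeBasis n).coord x := by
    refine (cubeBasis n).ext fun z => ?_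
    rw [LinearMap.comp_apply, cubeProj_cubeBasis]
    split_ifs with hz
    · rfl
    · have : z ≠ x := fun h => hz (h ▸ hx)
      simp [this]
  exact LinearMap.congr_fun key y

/-- The diagonal embedding of `𝔤𝔩ₙ(ℂ)` followed by conjugation in each copy. -/
def twistedDiag (k l m : K n) : Matrix (Fin n) (Fin n) ℂ →ₗ[ℂ] GlCube n :=
  cubeConj k l m ∘ₗ LinearMap.id.prod (LinearMap.id.prod LinearMap.id)

/-- The first copy kills the entries above the diagonal; the second, conjugated by the reversal
permutation, those below. What is left is diagonal, and the third copy makes it scalar. -/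
theorem eq_smul_one_of_cubeProj_eq_zero (hsep : SeparatesDiagonal h₃)
    {X : Matrix (Fin n) (Fin n) ℂ}
    (hX : cubeProj (tauHeight n) (tauHeight n) h₃
      (twistedDiag 1 (permK Fin.revPerm) (fullUnitary n) X) = 0) :
    ∃ c : ℂ, X = c • (1 : Matrix (Fin n) (Fin n) ℂ) := by
  have h0 : ∀ x ∈ cubePos (tauHeight n) (tauHeight n) h₃, (cubeBasis n).repr
      (twistedDiag 1 (permK Fin.revPerm) (fullUnitary n) X) x = 0 := fun x hx => by
    rw [← repr_cubeProj hx, hX]; simp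
  have e1 : ∀ i j, i < j → X i j = 0 := by
    intro i j hij
    have h1 := h0 (Sum.inl (i, j)) (by simp [cubePos, mem_posPairs_tauHeight, hij])
    change ((1 : K n).1 * X * (1 : K n).1ᴴ) i j = 0 at h1
    simpa using h1
  have e2 : ∀ i j, j < i → X i j = 0 := by
    intro i j hij
    have h1 := h0 (Sum.inr (Sum.inl (i.rev, j.rev)))
      (by simp [cubePos, mem_posPairs_tauHeight, hij])
    change ((permK Fin.revPerm).1 * X * (permK Fin.revPerm).1ᴴ : Matrix (Fin n) (Fin n) ℂ) i.rev j.rev = 0 at h1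
    rw [permK_conj] at h1
    simpa using h1
  refine hsep X (fun i j hij => ?_) fun p hp => ?_
  · rcases lt_or_gt_of_ne hij with h | h
    exacts [e1 i j h, e2 i j h]
  · exact h0 (Sum.inr (Sum.inr p)) (by simpa [cubePos] using hp)

/-- The kernel has dimension at most 1 and the target at most n² - 1, so rank-nullity gives
surjectivity. -/
theorem exists_cubeProj_twistedDiag_eq (hn : n ≠ 0) (hsep : SeparatesDiagonal h₃)
    (hN : (cubePos (tauHeight n) (tauHeight n) h₃).card + 1 = n * n) {x : CubeIndex n}
    (hx : x ∈ cubePos (tauHeight n) (tauHeight n) h₃) :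
    ∃ X, cubeProj (tauHeight n) (tauHeight n) h₃
      (twistedDiag 1 (permK Fin.revPerm) (fullUnitary n) X) = cubeBasis n x := by
  classical
  have : NeZero n := ⟨hn⟩
  let Ψ := cubeProj (tauHeight n) (tauHeight n) h₃ ∘ₗ
    twistedDiag 1 (permK Fin.revPerm) (fullUnitary n)
  let S : Submodule ℂ (GlCube n) :=
    Submodule.span ℂ ((cubePos (tauHeight n) (tauHeight n) h₃).image (cubeBasis n) : Set _)
  have hle : LinearMap.range Ψ ≤ S := by
    rintro _ ⟨X, rfl⟩
    rw [LinearMap.comp_apply, ← (cubeBasis n).sum_repr (twistedDiag _ _ _ X), map_sum]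
    refine S.sum_mem fun z _ => ?_
    rw [map_smul, cubeProj_cubeBasis]
    refine S.smul_mem _ ?_
    split_ifs with hz
    · exact Submodule.subset_span (Finset.mem_coe.2 (Finset.mem_image_of_mem _ hz))
    · exact S.zero_mem
  have hS : Module.finrank ℂ S ≤ (cubePos (tauHeight n) (tauHeight n) h₃).card :=
    (finrank_span_finset_le_card _).trans Finset.card_image_le
  have hker : Module.finrank ℂ (LinearMap.ker Ψ) ≤ 1 := by
    have h1 : LinearMap.ker Ψ ≤ ℂ ∙ (1 : Matrix (Fin n) (Fin n) ℂ) := by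
      intro X hX
      obtain ⟨c, hc⟩ := eq_smul_one_of_cubeProj_eq_zero hsep hX
      exact Submodule.mem_span_singleton.2 ⟨c, hc.symm⟩
    exact (Submodule.finrank_mono h1).trans (finrank_span_singleton one_ne_zero).le
  have hrk := LinearMap.finrank_range_add_finrank_ker Ψ
  rw [Module.finrank_matrix, Fintype.card_fin, Module.finrank_self, mul_one] at hrk
  have heq : LinearMap.range Ψ = S := Submodule.eq_of_le_of_finrank_le hle (by omega)
  have hxS : cubeBasis n x ∈ S :=
    Submodule.subset_span (Finset.mem_coe.2 (Finset.mem_image_of_mem _ hx))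
  rw [← heq] at hxS
  exact hxS

theorem exists_twistedDiag_ne_zero (hn : n ≠ 0) (hsep : SeparatesDiagonal h₃)
    (hN : (cubePos (tauHeight n) (tauHeight n) h₃).card = N) (hNn : N + 1 = n * n)
    (hA : ∀ s t u x, A (fun m => cubeConj (diagTorus s) (diagTorus t) (diagTorus u) (x m)) =
      weightChar (sumPos (tauHeight n)) s * weightChar (sumPos (tauHeight n)) t *
        weightChar (sumPos h₃) u * A x) (hA0 : A ≠ 0) :
    ∃ X : Fin N → Matrix (Fin n) (Fin n) ℂ,
      A (fun m => twistedDiag 1 (permK Fin.revPerm) (fullUnitary n) (X m)) ≠ 0 := by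
  obtain ⟨r, hr⟩ : ∃ r : Fin N → CubeIndex n, A (fun m => cubeBasis n (r m)) ≠ 0 := by
    by_contra! h
    exact hA0 (Module.Basis.ext_alternating (cubeBasis n) fun r _ => h r)
  choose X hX using fun m => exists_cubeProj_twistedDiag_eq hn hsep (hN ▸ hNn)
    (mem_cubePos_of_ne_zero hN hA hr m)
  refine ⟨X, ?_⟩
  rw [← apply_cubeProj hN hA]
  simpa only [hX] using hr

end CubeForms

/-! ### Nonvanishing, invariance and the conclusion -/

section Main

variable {n : ℕ} {V W : Type*} [AddCommGroup V] [Module ℂ V] [AddCommGroup W] [Module ℂ W]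
  {τ : Representation ℂ (K n) V} {σ : Representation ℂ (K n) W} {N : ℕ}

theorem intertwining_apply (η : Representation.IntertwiningMap
      (extPower (adGModKCube n) N) (outerTensor τ τ σ)) (k l m : K n)
    (x : ⋀[ℂ]^N (GModK n × GModK n × GModK n)) :
    η.toLinearMap (extPower (adGModKCube n) N (k, l, m) x) =
      TensorProduct.map (τ k) (TensorProduct.map (τ l) (σ m)) (η.toLinearMap x) :=
  LinearMap.congr_fun (η.isIntertwining' (k, l, m)) x

/-- Contracting the other two factors of η with a suitable functional gives a nonzero map onto τ,
equivariant for the first copy of K, from a smooth representation. -/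
theorem isSmooth_of_intertwining_left [FiniteDimensional ℂ V] [FiniteDimensional ℂ W]
    (hτ : τ.IsIrreducible)
    (η : Representation.IntertwiningMap (extPower (adGModKCube n) N) (outerTensor τ τ σ))
    {x : ⋀[ℂ]^N (GModK n × GModK n × GModK n)} (hx : η.toLinearMap x ≠ 0) : IsSmooth τ := by
  have h1 : TensorProduct.comm ℂ V (V ⊗[ℂ] W) (η.toLinearMap x) ≠ 0 := by simpa using hx
  obtain ⟨ψ, hψ⟩ : ∃ ψ, contrL ψ (TensorProduct.comm ℂ V (V ⊗[ℂ] W) (η.toLinearMap x)) ≠ 0 := by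
    by_contra! h
    exact h1 (eq_zero_of_contrL h)
  let i : K n →* K n × K n × K n := MonoidHom.inl _ _
  refine ((isSmooth_adGModKCube i (Or.inl fun _ => rfl)).extPower N).of_ne_zero hτ
    (contrL ψ ∘ₗ (TensorProduct.comm ℂ V (V ⊗[ℂ] W)).toLinearMap ∘ₗ η.toLinearMap)
    (fun h => hψ (LinearMap.congr_fun h x)) fun k y => ?_
  have h2 : η.toLinearMap (extPower ((adGModKCube n).comp i) N k y) = _ :=
    intertwining_apply η k 1 1 y
  simp only [LinearMap.comp_apply, LinearEquiv.coe_coe]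
  rw [h2]
  have h3 : ∀ t : V ⊗[ℂ] (V ⊗[ℂ] W), contrL ψ (TensorProduct.comm ℂ V (V ⊗[ℂ] W)
      (TensorProduct.map (τ k) (TensorProduct.map (τ 1) (σ 1)) t)) =
      τ k (contrL ψ (TensorProduct.comm ℂ V (V ⊗[ℂ] W) t)) := by
    intro t
    rw [map_one, map_one, TensorProduct.map_one]
    induction t with
    | zero => simp
    | add x y hx hy => simp only [map_add, hx, hy]
    | tmul x y => simp
  exact h3 _

theorem isSmooth_of_intertwining_right [FiniteDimensional ℂ V] [FiniteDimensional ℂ W]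
    (hσ : σ.IsIrreducible)
    (η : Representation.IntertwiningMap (extPower (adGModKCube n) N) (outerTensor τ τ σ))
    {x : ⋀[ℂ]^N (GModK n × GModK n × GModK n)} (hx : η.toLinearMap x ≠ 0) : IsSmooth σ := by
  obtain ⟨φ, hφ⟩ : ∃ φ, contrL φ (η.toLinearMap x) ≠ 0 := by
    by_contra! h
    exact hx (eq_zero_of_contrL h)
  obtain ⟨ψ, hψ⟩ : ∃ ψ, contrL ψ (contrL φ (η.toLinearMap x)) ≠ 0 := by
    by_contra! h
    exact hφ (eq_zero_of_contrL h)
  let i : K n →* K n × K n × K n := (MonoidHom.inr _ _).comp (MonoidHom.inr _ _)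
  refine ((isSmooth_adGModKCube i (Or.inr (Or.inr fun _ => rfl))).extPower N).of_ne_zero hσ
    (contrL ψ ∘ₗ contrL φ ∘ₗ η.toLinearMap)
    (fun h => hψ (LinearMap.congr_fun h x)) fun k y => ?_
  have h2 : η.toLinearMap (extPower ((adGModKCube n).comp i) N k y) = _ :=
    intertwining_apply η 1 1 k y
  simp only [LinearMap.comp_apply]
  rw [h2, contrL_map, contrL_map, map_one]
  rfl

/-- The map `𝔤𝔩ₙ(ℂ)³ → (𝔤/𝔨̃)³`. -/
def cubeToQuot (n : ℕ) : GlCube n →ₗ[ℂ] GModK n × GModK n × GModK n :=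
  (glToQuot n).prodMap ((glToQuot n).prodMap (glToQuot n))

theorem cubeToQuot_surjective : Function.Surjective (cubeToQuot n) :=
  glToQuot_surjective.prodMap (glToQuot_surjective.prodMap glToQuot_surjective)

theorem cubeToQuot_cubeConj (k l m : K n) (x : GlCube n) :
    cubeToQuot n (cubeConj k l m x) = adGModKCube n (k, l, m) (cubeToQuot n x) :=
  Prod.ext (adGModK_glToQuot k x.1).symm
    (Prod.ext (adGModK_glToQuot l x.2.1).symm (adGModK_glToQuot m x.2.2).symm)

theorem extPower_ιMulti_cubeToQuot (k l m : K n) (x : Fin N → GlCube n) :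
    exteriorPower.ιMulti ℂ N (fun i => cubeToQuot n (cubeConj k l m (x i))) =
      extPower (adGModKCube n) N (k, l, m)
        (exteriorPower.ιMulti ℂ N fun i => cubeToQuot n (x i)) := by
  simp only [cubeToQuot_cubeConj]
  exact (exteriorPower.map_apply_ιMulti _ _).symm

/-- The linear map on the exterior power induced by the diagonal embedding. -/
def diagExt (n N : ℕ) : ⋀[ℂ]^N (GModK n) →ₗ[ℂ] ⋀[ℂ]^N (GModK n × GModK n × GModK n) :=
  exteriorPower.map N (LinearMap.id.prod (LinearMap.id.prod LinearMap.id))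

theorem comp_diagExt_ne_zero (hn : n ≠ 0) {h : Fin n → ℤ} (hsep : SeparatesDiagonal h)
    (hN : (cubePos (tauHeight n) (tauHeight n) h).card = N) (hNn : N + 1 = n * n)
    (hτ : IsKType (sumPos (tauHeight n)) τ) (hσ : IsKType (sumPos h) σ)
    (η : Representation.IntertwiningMap (extPower (adGModKCube n) N) (outerTensor τ τ σ))
    {x : ⋀[ℂ]^N (GModK n × GModK n × GModK n)} (hx : η.toLinearMap x ≠ 0) :
    η.toLinearMap ∘ₗ diagExt n N ≠ 0 := by
  have := hτ.finiteDimensional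
  have := hσ.finiteDimensional
  obtain ⟨v, hv, hvw⟩ := hτ.isWeight
  obtain ⟨w, hw, hww⟩ := hσ.isWeight
  obtain ⟨f, hfv, hf⟩ := exists_dual_hasWeight hτ.continuous hv hvw
  obtain ⟨g, hgw, hg⟩ := exists_dual_hasWeight hσ.continuous hw hww
  have hf0 : f ≠ 0 := fun h => hfv (by simp [h])
  have hg0 : g ≠ 0 := fun h => hgw (by simp [h])
  have hf' : ∀ t, f ∘ₗ τ (diagTorus t) = weightChar (sumPos (tauHeight n)) t • f :=
    fun t => LinearMap.ext (hf t)
  have hg' : ∀ t, g ∘ₗ σ (diagTorus t) = weightChar (sumPos h) t • g :=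
    fun t => LinearMap.ext (hg t)
  let Φ : ⋀[ℂ]^N (GModK n × GModK n × GModK n) →ₗ[ℂ] ℂ := tri f f g ∘ₗ η.toLinearMap
  let A : GlCube n [⋀^Fin N]→ₗ[ℂ] ℂ :=
    (Φ.compAlternatingMap (exteriorPower.ιMulti ℂ N)).compLinearMap (cubeToQuot n)
  have hA_apply : ∀ y : Fin N → GlCube n, A y =
      tri f f g (η.toLinearMap (exteriorPower.ιMulti ℂ N fun i => cubeToQuot n (y i))) :=
    fun _ => rfl
  have hA : ∀ s t u y, A (fun m => cubeConj (diagTorus s) (diagTorus t) (diagTorus u) (y m)) =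
      weightChar (sumPos (tauHeight n)) s * weightChar (sumPos (tauHeight n)) t *
        weightChar (sumPos h) u * A y := by
    intro s t u y
    rw [hA_apply, hA_apply, extPower_ιMulti_cubeToQuot, intertwining_apply, tri_map, hf', hf', hg']
    simp only [tri_apply, map_smul, LinearMap.smul_apply, smul_eq_mul]
    ring
  -- Irreducibility makes some K³-translate of η(x) visible to f ⊗ f ⊗ g, and that translate is
  -- again a value of η.
  have hA0 : A ≠ 0 := by
    intro h0
    obtain ⟨k, l, m, hne⟩ := exists_tri_ne_zero hτ.irreducible hτ.irreducible hσ.irreducible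
      hf0 hf0 hg0 hx
    rw [← intertwining_apply] at hne
    have hΦ : Φ = 0 := by
      refine exteriorPower.linearMap_ext (AlternatingMap.ext fun y => ?_)
      choose z hz using fun i => cubeToQuot_surjective (y i)
      have h1 : A z = 0 := by rw [h0]; rfl
      rw [hA_apply] at h1
      simp only [hz] at h1
      exact h1
    exact hne (LinearMap.congr_fun hΦ _)
  obtain ⟨X, hX⟩ := exists_twistedDiag_ne_zero hn hsep hN hNn hA hA0
  intro h0
  apply hX
  have h1 := LinearMap.congr_fun h0 (exteriorPower.ιMulti ℂ N fun i => glToQuot n (X i))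
  have h2 : diagExt n N (exteriorPower.ιMulti ℂ N fun i => glToQuot n (X i)) =
      exteriorPower.ιMulti ℂ N fun i => cubeToQuot n (X i, X i, X i) :=
    exteriorPower.map_apply_ιMulti _ _
  rw [LinearMap.comp_apply, h2, LinearMap.zero_apply] at h1
  rw [hA_apply]
  -- The twisted diagonal is a K³-translate of the plain one, on which η is assumed to vanish.
  have h3 := extPower_ιMulti_cubeToQuot 1 (permK Fin.revPerm) (fullUnitary n)
    fun i => (X i, X i, X i)
  refine (congrArg (fun z => tri f f g (η.toLinearMap z)) h3).trans ?_
  rw [intertwining_apply, h1, map_zero, map_zero]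

theorem comp_diagExt_mem_invariants (hn : n ≠ 0) (hNn : N + 1 = n * n)
    (η : Representation.IntertwiningMap (extPower (adGModKCube n) N) (outerTensor τ τ σ))
    (y : ⋀[ℂ]^N (GModK n)) :
    (η.toLinearMap ∘ₗ diagExt n N) y ∈ (τ.tprod (τ.tprod σ)).invariants := by
  intro k
  have hfr : Module.finrank ℂ (GModK n) = N := by
    have := finrank_gModK hn
    omega
  have key : (η.toLinearMap ∘ₗ diagExt n N) ∘ₗ exteriorPower.map N (adGModK n k) =
      η.toLinearMap ∘ₗ diagExt n N := by
    refine exteriorPower.linearMap_ext (AlternatingMap.ext fun x => ?_)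
    have h1 := alternatingMap_apply_comp hfr
      ((η.toLinearMap ∘ₗ diagExt n N).compAlternatingMap (exteriorPower.ιMulti ℂ N))
      (adGModK n k) x
    rw [det_adGModK hn, one_smul] at h1
    rw [← h1]
    exact congrArg (η.toLinearMap ∘ₗ diagExt n N) (exteriorPower.map_apply_ιMulti _ _)
  have h2 := intertwining_apply η k k k (diagExt n N y)
  have h3 : extPower (adGModKCube n) N (k, k, k) (diagExt n N y) =
      diagExt n N (exteriorPower.map N (adGModK n k) y) := by
    have h4 : exteriorPower.map N (adGModKCube n (k, k, k)) ∘ₗ diagExt n N =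
        diagExt n N ∘ₗ exteriorPower.map N (adGModK n k) := by
      rw [diagExt, ← exteriorPower.map_comp, ← exteriorPower.map_comp]
      rfl
    exact LinearMap.congr_fun h4 y
  rw [h3] at h2
  exact h2.symm.trans (LinearMap.congr_fun key y)

/-- A nonzero range inside a space of dimension at most one fills it. -/
theorem range_comp_diagExt (hn : n ≠ 0) {h : Fin n → ℤ} (hh : Antitone h)
    (hab : IsAbelianHeight h) (hsep : SeparatesDiagonal h)
    (hN : (cubePos (tauHeight n) (tauHeight n) h).card = N) (hNn : N + 1 = n * n)
    (hτ : IsKType (sumPos (tauHeight n)) τ) (hσ : IsKType (sumPos h) σ)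
    (η : Representation.IntertwiningMap (extPower (adGModKCube n) N) (outerTensor τ τ σ))
    (hη : η ≠ 0) :
    η.toLinearMap ∘ₗ diagExt n N ≠ 0 ∧
    LinearMap.range (η.toLinearMap ∘ₗ diagExt n N) = (τ.tprod (τ.tprod σ)).invariants ∧
    Module.finrank ℂ (τ.tprod (τ.tprod σ)).invariants = 1 := by
  have := hτ.finiteDimensional
  have := hσ.finiteDimensional
  obtain ⟨x, hx⟩ : ∃ x, η.toLinearMap x ≠ 0 := by
    by_contra! h0
    exact hη (Representation.IntertwiningMap.ext (LinearMap.ext h0))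
  have h1 := comp_diagExt_ne_zero hn hsep hN hNn hτ hσ η hx
  have h2 := finrank_invariants_le_one hτ hσ hh hab
    (isSmooth_of_intertwining_left hτ.irreducible η hx)
    (isSmooth_of_intertwining_right hσ.irreducible η hx)
  have h3 : LinearMap.range (η.toLinearMap ∘ₗ diagExt n N) ≤ (τ.tprod (τ.tprod σ)).invariants := by
    rintro _ ⟨y, rfl⟩
    exact comp_diagExt_mem_invariants hn hNn η y
  have h4 : 1 ≤ Module.finrank ℂ (LinearMap.range (η.toLinearMap ∘ₗ diagExt n N)) := by
    rw [Submodule.one_le_finrank_iff]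
    exact fun h => h1 (LinearMap.range_eq_bot.1 h)
  have h5 := Submodule.finrank_mono h3
  exact ⟨h1, Submodule.eq_of_le_of_finrank_le h3 (h2.trans h4), by omega⟩

theorem two_mul_b_add_c (hn : 2 ≤ n) : 2 * b n + c n + 1 = n * n := by
  have h1 : 2 * b n = n * (n - 1) := Nat.two_mul_div_two_of_even (Nat.even_mul_pred_self n)
  obtain ⟨m, rfl⟩ : ∃ m, n = m + 1 := ⟨n - 1, by omega⟩
  rw [h1, c, Nat.add_sub_cancel]
  ring

end Main

end RankinSelberg

end

theorem mainTheorem9 (n : ℕ) (hn : 2 ≤ n)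
    {V W : Type*} [AddCommGroup V] [Module ℂ V] [AddCommGroup W] [Module ℂ W]
    (τ : Representation ℂ (RankinSelberg.K n) V) (σ : Representation ℂ (RankinSelberg.K n) W)
    (hτ : RankinSelberg.IsKType (RankinSelberg.tauWeight n) τ)
    (hσ : RankinSelberg.IsKType (RankinSelberg.sigmaWeight n) σ ∨
      RankinSelberg.IsKType (RankinSelberg.sigmaWeight' n) σ)
    (η : Representation.IntertwiningMap
      (RankinSelberg.extPower (RankinSelberg.adGModKCube n)
        (2 * RankinSelberg.b n + RankinSelberg.c n))
      (RankinSelberg.outerTensor τ τ σ))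
    (hη : η ≠ 0) :
    η.toLinearMap ∘ₗ RankinSelberg.iota n ≠ 0 ∧
    LinearMap.range (η.toLinearMap ∘ₗ RankinSelberg.iota n) =
      (τ.tprod (τ.tprod σ)).invariants ∧
    Module.finrank ℂ (τ.tprod (τ.tprod σ)).invariants = 1 := by
  have hn0 : n ≠ 0 := by omega
  rw [← RankinSelberg.sumPos_tauHeight] at hτ
  rcases hσ with hσ | hσ
  · rw [← RankinSelberg.sumPos_sigmaHeight hn] at hσ
    refine RankinSelberg.range_comp_diagExt hn0 RankinSelberg.antitone_sigmaHeight
      RankinSelberg.isAbelianHeight_sigmaHeight (RankinSelberg.separatesDiagonal_sigmaHeight hn) ?_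
      (RankinSelberg.two_mul_b_add_c hn) hτ hσ η hη
    rw [RankinSelberg.cubePos, Finset.card_disjSum, Finset.card_disjSum,
      RankinSelberg.card_posPairs_tauHeight, RankinSelberg.card_posPairs_sigmaHeight hn]
    ring
  · rw [← RankinSelberg.sumPos_sigmaHeight' hn] at hσ
    refine RankinSelberg.range_comp_diagExt hn0 RankinSelberg.antitone_sigmaHeight'
      RankinSelberg.isAbelianHeight_sigmaHeight'
      (RankinSelberg.separatesDiagonal_sigmaHeight' hn) ?_
      (RankinSelberg.two_mul_b_add_c hn) hτ hσ η hη
    rw [RankinSelberg.cubePos, Finset.card_disjSum, Finset.card_disjSum,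
      RankinSelberg.card_posPairs_tauHeight, RankinSelberg.card_posPairs_sigmaHeight' hn]
    ring
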